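/- Conventions. For a set $L$, an $L$-coloured tree is a finite binary tree whose leaves are labelled by elements of $L$; write $T_L$ for the set of all of them, $\bullet_x$ for the one-leaf tree with label $x$, and $t_1t_2$ for the tree with left subtree $t_1$ and right subtree $t_2$. A left cancellative LD-system is a set $L$ with a binary operation $x,y\mapsto x[y]$ satisfying $x[y[z]]=x[y][x[z]]$ and such that $x[y]=x[z]$ implies $y=z$. For such an $L$ and $t_1,t_2\in T_L$, let $t_1[t_2]$ be the tree obtained from $t_2$ by replacing each label $y$ with $x_1[x_2[\cdots x_n[y]\cdots]]$, where $(x_1,\dots,x_n)$ is the left-to-right enumeration of the labels of $t_1$. An address is a finite sequence $\alpha$ of $0$'s (left) and $1$'s (right); for a partial operator $f$ on trees, its translate $f_\alpha$ at $\alpha$ applies $f$ to the subtree at $\alpha$ (and is undefined if that subtree does not exist or is not in the domain of $f$), leaving the rest of the tree unchanged. Let $T^\#$ be the disjoint union of the sets $T_L$ over all left cancellative LD-systems $L$ (in an arbitrary fixed universe). Let $A_\alpha$ be the translate at $\alpha$ of the partial operator $t_1(t_2t_3)\mapsto (t_1t_2)t_3$ on $T^\#$, and let $S^\#_\alpha$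 be the partial operator on $T^\#$ that is the union, over all $L$, of the translates at $\alpha$ of the twisted semi-commutation operators $t_1(t_2t_3)\mapsto t_1[t_2]\,(t_1t_3)$ on $T_L$. These are partial injections of $T^\#$ into itself. Let $\mathcal G(\mathcal A,\mathcal S^\#)$ be the monoid of partial injections of $T^\#$ generated by all $A_\alpha$, all $S^\#_\alpha$ and their inverses, under reversed composition ($fg$ means $f$, then $g$). Two partial maps $g,g'$ are near-equal, $g\approx g'$, if there is at least one $t$ at which both are defined and $g,g'$ agree at every such $t$. Let $B_\bullet$ be the group generated by $a_1,a_2,\dots,\sigma_1,\sigma_2,\dots$ subject to the relations, for $i\ge 1$, $$a_i x_{j-1}=x_j a_i,\qquad \sigma_i x_j=x_j\sigma_i\qquad (j\ge i+2,\ x=a\text{ or }\sigma),$$ $$\sigma_i\sigma_{i+1}\sigma_i=\sigma_{i+1}\sigma_i\sigma_{i+1},\qquad \sigma_{i+1}\sigma_i a_{i+1}=a_i\sigma_i,\qquad \sigma_i\sigma_{i+1}a_i=a_{i+1}\sigma_i .$$ **Proposition 5.12.** Near-equality is a congruence on the monoid $\mathcal G(\mathcal A,\mathcal S^\#)$, and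 the quotient monoid $G(\mathcal A,\mathcal S^\#)=\mathcal G(\mathcal A,\mathcal S^\#)/{\approx}$ is a group isomorphic to $B_\bullet$. -/

import Mathlib

universe u v

namespace GeomGroup

open scoped Quandles

/-! ### Partial self-injections -/

/-- Partial injections of `T` into itself form a monoid under reversed composition:
`f * g` means "`f`, then `g`". -/
instance instMonoidPEquiv {T : Type u} : Monoid (T ≃. T) where
  mul f g := f.trans g
  one := PEquiv.refl T
  mul_assoc := PEquiv.trans_assoc
  one_mul := PEquiv.refl_trans
  mul_one := PEquiv.trans_refl

open Classical in
/-- The partial injection whose graph is the given set of pairs. -/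
noncomputable def ofGraph {T : Type u} (r : T → T → Prop) (hr : Relator.BiUnique r) : T ≃. T where
  toFun t := if h : ∃ t', r t t' then some h.choose else none
  invFun t' := if h : ∃ t, r t t' then some h.choose else none
  inv t t' := by
    constructor
    · intro h
      split_ifs at h with h1
      have h2 : r t t' := by
        have h3 := h1.choose_spec
        rwa [Option.some.inj h] at h3
      have h4 : ∃ t', r t t' := ⟨t', h2⟩
      rw [dif_pos h4]
      exact congrArg some (hr.2 h4.choose_spec h2)
    · intro h
      split_ifs at h with h1
      have h2 : r t t' := by
        have h3 := h1.choose_spec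
        rwa [Option.some.inj h] at h3
      have h4 : ∃ t, r t t' := ⟨t, h2⟩
      rw [dif_pos h4]
      exact congrArg some (hr.1 h4.choose_spec h2)

theorem ofGraph_eq_some {T : Type u} (r : T → T → Prop) (hr : Relator.BiUnique r) (t t' : T) :
    ofGraph r hr t = some t' ↔ r t t' := by
  classical
  change (if h : ∃ t', r t t' then some h.choose else none) = some t' ↔ _
  constructor
  · intro h
    split_ifs at h with h1
    have h3 := h1.choose_spec
    rwa [Option.some.inj h] at h3
  · intro h
    have h4 : ∃ t', r t t' := ⟨t', h⟩
    rw [dif_pos h4]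
    exact congrArg some (hr.2 h4.choose_spec h)

/-- Near-equality of two partial maps: their domains meet, and they agree wherever both are
defined. -/
def NearEq {T : Type u} (f g : T ≃. T) : Prop :=
  (∃ t, (f t).isSome ∧ (g t).isSome) ∧ ∀ t, (f t).isSome → (g t).isSome → f t = g t

/-! ### Coloured trees

An `L`-coloured finite binary tree is an element of `FreeMagma L`: `FreeMagma.of x` is the
one-leaf tree with label `x`, and `t₁ * t₂` is the tree with left subtree `t₁` and right
subtree `t₂`. An address is a list of Booleans read from the root; `false` means "go left",
`true` means "go right". -/

/-- The `α`-shift of a partial operator (given by its graph) on trees: apply it to the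
`α`-subtree, which has to exist, and leave the rest of the tree unchanged. -/
def Shift {L : Type u} (r : FreeMagma L → FreeMagma L → Prop) :
    List Bool → FreeMagma L → FreeMagma L → Prop
  | [] => r
  | false :: α => fun t t' =>
      ∃ t₁ t₁' t₂, t = t₁ * t₂ ∧ t' = t₁' * t₂ ∧ Shift r α t₁ t₁'
  | true :: α => fun t t' =>
      ∃ t₁ t₂ t₂', t = t₁ * t₂ ∧ t' = t₁ * t₂' ∧ Shift r α t₂ t₂'

/-- The graph of the associativity operator `t₁(t₂t₃) ↦ (t₁t₂)t₃`. -/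
def AssocRel {L : Type u} (t t' : FreeMagma L) : Prop :=
  ∃ t₁ t₂ t₃ : FreeMagma L, t = t₁ * (t₂ * t₃) ∧ t' = (t₁ * t₂) * t₃

/-- The left-to-right enumeration of the labels of a tree. -/
def labels {L : Type u} : FreeMagma L → List L
  | FreeMagma.of x => [x]
  | FreeMagma.mul t₁ t₂ => labels t₁ ++ labels t₂

/-- The bracket `t₁[t₂]` on trees: replace each label `y` of `t₂` with
`x₁[x₂[… xₙ[y] …]]`, where `x₁, …, xₙ` are the labels of `t₁` from left to right. -/
def treeBracket {L : Type u} [Shelf L] (t₁ t₂ : FreeMagma L) : FreeMagma L :=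
  FreeMagma.map (fun y => (labels t₁).foldr (fun x z => x ◃ z) y) t₂

/-- The graph of the twisted semi-commutation operator `t₁(t₂t₃) ↦ t₁[t₂](t₁t₃)`. -/
def SemiRel {L : Type u} [Shelf L] (t t' : FreeMagma L) : Prop :=
  ∃ t₁ t₂ t₃ : FreeMagma L, t = t₁ * (t₂ * t₃) ∧ t' = treeBracket t₁ t₂ * (t₁ * t₃)

/-- A left cancellative LD-system: a set with a left self-distributive operation (a `Shelf`)
whose left translations are injective. -/
structure LCSystem where
  carrier : Type u
  [shelf : Shelf carrier]
  left_cancel : ∀ x : carrier, Function.Injective (fun y : carrier => x ◃ y)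

attribute [instance] LCSystem.shelf

/-- The (disjoint) union of the sets of `L`-coloured trees, over all left cancellative
LD-systems `L`. -/
abbrev AllTrees : Type (u + 1) := Σ L : LCSystem.{u}, FreeMagma L.carrier

/-- The graph of `A_α`, acting on all coloured trees. -/
inductive AssocAll (α : List Bool) : AllTrees.{u} → AllTrees.{u} → Prop
  | of (L : LCSystem.{u}) (t t' : FreeMagma L.carrier) (h : Shift AssocRel α t t') :
      AssocAll α ⟨L, t⟩ ⟨L, t'⟩

/-- The graph of `S_α^#`: the union of the graphs of the twisted semi-commutation operators
at address `α` over all left cancellative LD-systems. -/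
inductive SemiAll (α : List Bool) : AllTrees.{u} → AllTrees.{u} → Prop
  | of (L : LCSystem.{u}) (t t' : FreeMagma L.carrier) (h : Shift SemiRel α t t') :
      SemiAll α ⟨L, t⟩ ⟨L, t'⟩

/-! These graphs are graphs of partial injections. -/

theorem mul_inj_iff {L : Type u} {a b c d : FreeMagma L} : a * b = c * d ↔ a = c ∧ b = d := by
  constructor
  · intro h
    change FreeMagma.mul a b = FreeMagma.mul c d at h
    cases h
    exact ⟨rfl, rfl⟩
  · rintro ⟨rfl, rfl⟩
    rfl

theorem map_injective {L : Type u} {M : Type v} {f : L → M} (hf : Function.Injective f) :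
    Function.Injective (FreeMagma.map f) := by
  intro s
  induction s using FreeMagma.rec with
  | of x =>
    intro t h
    cases t with
    | of y =>
      change FreeMagma.of (f x) = FreeMagma.of (f y) at h
      injection h with h'
      rw [hf h']
    | mul a b =>
      change FreeMagma.of (f x) = FreeMagma.mul (FreeMagma.map f a) (FreeMagma.map f b) at h
      cases h
  | mul a b iha ihb =>
    intro t h
    cases t with
    | of y =>
      change FreeMagma.mul (FreeMagma.map f a) (FreeMagma.map f b) = FreeMagma.of (f y) at h
      cases h
    | mul c d =>
      change FreeMagma.map f a * FreeMagma.map f b = FreeMagma.map f c * FreeMagma.map f d at h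
      obtain ⟨h1, h2⟩ := mul_inj_iff.1 h
      rw [iha h1, ihb h2]

theorem treeBracket_injective (L : LCSystem.{u}) (t : FreeMagma L.carrier) :
    Function.Injective (treeBracket t) := by
  apply map_injective
  induction labels t with
  | nil => exact fun _ _ h => h
  | cons x l ih => exact fun _ _ h => ih (L.left_cancel x h)

theorem Shift.biUnique {L : Type u} {r : FreeMagma L → FreeMagma L → Prop}
    (hr : Relator.BiUnique r) (α : List Bool) : Relator.BiUnique (Shift r α) := by
  induction α with
  | nil => exact hr
  | cons b α ih =>
    cases b
    · constructor
      · rintro x y z ⟨a, a', b, rfl, rfl, h⟩ ⟨c, c', d, rfl, h', k⟩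
        obtain ⟨rfl, rfl⟩ := mul_inj_iff.1 h'
        rw [ih.1 h k]
      · rintro x y z ⟨a, a', b, rfl, rfl, h⟩ ⟨c, c', d, h', rfl, k⟩
        obtain ⟨rfl, rfl⟩ := mul_inj_iff.1 h'
        rw [ih.2 h k]
    · constructor
      · rintro x y z ⟨a, b, b', rfl, rfl, h⟩ ⟨c, d, d', rfl, h', k⟩
        obtain ⟨rfl, rfl⟩ := mul_inj_iff.1 h'
        rw [ih.1 h k]
      · rintro x y z ⟨a, b, b', rfl, rfl, h⟩ ⟨c, d, d', h', rfl, k⟩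
        obtain ⟨rfl, rfl⟩ := mul_inj_iff.1 h'
        rw [ih.2 h k]

theorem AssocRel.biUnique (L : Type u) :
    Relator.BiUnique (AssocRel : FreeMagma L → FreeMagma L → Prop) := by
  constructor
  · rintro x y z ⟨a, b, c, rfl, rfl⟩ ⟨d, e, f, rfl, h⟩
    simp only [mul_inj_iff] at h
    obtain ⟨⟨rfl, rfl⟩, rfl⟩ := h
    rfl
  · rintro x y z ⟨a, b, c, rfl, rfl⟩ ⟨d, e, f, h, rfl⟩
    simp only [mul_inj_iff] at h
    obtain ⟨rfl, rfl, rfl⟩ := h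
    rfl

theorem SemiRel.biUnique (L : LCSystem.{u}) :
    Relator.BiUnique (SemiRel : FreeMagma L.carrier → FreeMagma L.carrier → Prop) := by
  constructor
  · rintro x y z ⟨a, b, c, rfl, rfl⟩ ⟨d, e, f, rfl, h⟩
    simp only [mul_inj_iff] at h
    obtain ⟨h, rfl, rfl⟩ := h
    rw [treeBracket_injective L _ h]
  · rintro x y z ⟨a, b, c, rfl, rfl⟩ ⟨d, e, f, h, rfl⟩
    simp only [mul_inj_iff] at h
    obtain ⟨rfl, rfl, rfl⟩ := h
    rfl

theorem AssocAll.biUnique (α : List Bool) : Relator.BiUnique (AssocAll.{u} α) := by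
  constructor
  · rintro _ _ _ ⟨L, t, t', h⟩ ⟨_, s, _, k⟩
    rw [(Shift.biUnique (AssocRel.biUnique _) α).1 h k]
  · rintro _ _ _ ⟨L, t, t', h⟩ ⟨_, _, s, k⟩
    rw [(Shift.biUnique (AssocRel.biUnique _) α).2 h k]

theorem SemiAll.biUnique (α : List Bool) : Relator.BiUnique (SemiAll.{u} α) := by
  constructor
  · rintro _ _ _ ⟨L, t, t', h⟩ ⟨_, s, _, k⟩
    rw [(Shift.biUnique (SemiRel.biUnique _) α).1 h k]
  · rintro _ _ _ ⟨L, t, t', h⟩ ⟨_, _, s, k⟩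
    rw [(Shift.biUnique (SemiRel.biUnique _) α).2 h k]

/-! ### The geometry monoid -/

/-- The operator `A_α` on all coloured trees. -/
noncomputable def opA (α : List Bool) : AllTrees.{u} ≃. AllTrees.{u} :=
  ofGraph (AssocAll α) (AssocAll.biUnique α)

/-- The operator `S_α^#`. -/
noncomputable def opS (α : List Bool) : AllTrees.{u} ≃. AllTrees.{u} :=
  ofGraph (SemiAll α) (SemiAll.biUnique α)

/-- The geometry monoid `𝒢(𝒜, 𝒮^#)`, generated by all `A_α`, all `S_α^#` and their inverses. -/
def geomMonoid : Submonoid (AllTrees.{u} ≃. AllTrees.{u}) :=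
  Submonoid.closure
    {f | ∃ α : List Bool, f = opA α ∨ f = (opA α).symm ∨ f = opS α ∨ f = (opS α).symm}

/-! ### The group `B_•` -/

/-- The generators of `B_•`; `a i` and `σ i` stand for the `(i+1)`-st generators
`a_{i+1}` and `σ_{i+1}` when numbering starts from `1`. -/
inductive BGen : Type
  | a (i : ℕ)
  | σ (i : ℕ)

/-- The generator `a` as an element of the free group. -/
def ga (i : ℕ) : FreeGroup BGen := FreeGroup.of (BGen.a i)

/-- The generator `σ` as an element of the free group. -/
def gσ (i : ℕ) : FreeGroup BGen := FreeGroup.of (BGen.σ i)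

/-- The relators of `B_•`: the constructor for a relation `u = v` gives `u * v⁻¹`. -/
inductive BRel : FreeGroup BGen → Prop
  | aa (i j : ℕ) (h : i + 2 ≤ j) : BRel ((ga i * ga (j - 1)) * (ga j * ga i)⁻¹)
  | aσ (i j : ℕ) (h : i + 2 ≤ j) : BRel ((ga i * gσ (j - 1)) * (gσ j * ga i)⁻¹)
  | σa (i j : ℕ) (h : i + 2 ≤ j) : BRel ((gσ i * ga j) * (ga j * gσ i)⁻¹)
  | σσ (i j : ℕ) (h : i + 2 ≤ j) : BRel ((gσ i * gσ j) * (gσ j * gσ i)⁻¹)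
  | braid (i : ℕ) :
      BRel ((gσ i * gσ (i + 1) * gσ i) * (gσ (i + 1) * gσ i * gσ (i + 1))⁻¹)
  | mixed₁ (i : ℕ) : BRel ((gσ (i + 1) * gσ i * ga (i + 1)) * (ga i * gσ i)⁻¹)
  | mixed₂ (i : ℕ) : BRel ((gσ i * gσ (i + 1) * ga i) * (ga (i + 1) * gσ i)⁻¹)

/-- The group `B_•`. -/
abbrev BBullet : Type := PresentedGroup {w : FreeGroup BGen | BRel w}

end GeomGroup

/-! A tree is read as the sequence of subtrees hanging from its right spine. On such sequences the
associativity operator at the address $1^i$ merges two consecutive trees, as `bA i` should, and the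
semi-commutation operator exchanges them while acting on labels, as `bS i` should. An operator at an
address that enters a left subtree becomes a conjugate by splittings, that is, by inverses of `bA`.
Hence every element $f$ of the geometry monoid follows some $x$ in $B_\bullet$, in the sense of
`Tracks`. The theorem then amounts to `Tracks.nearEq_iff`: if $f,g$ follow $x,y$, then $f\approx g$
iff $x=y$. So near-equality is the kernel of a homomorphism onto $B_\bullet$. Three ingredients
carry this.

Faithfulness (`bModel`). $B_\bullet$ is itself a left cancellative LD-system under
$x[y]=x\,\mathrm{sh}(y)\,\sigma_1\,\mathrm{sh}(x)^{-1}$, and a sequence of trees coloured by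
$B_\bullet$ evaluates to an element on which $B_\bullet$ acts by right multiplication. One tree at
which $f$ and $g$ are both defined and agree therefore gives $x=y$. Left cancellation requires
`sh_injective`.

Separation (`slotModel`). For each $L$, $B_\bullet$ acts on a set into which all $L$-coloured trees
embed, so $x=y$ forces $f$ and $g$ to agree wherever both are defined. Merging is made invertible by
coding shapes with the bijection `Nat.pair`, and crossing by inverting the full twist.

Common domains (`Tracks.exists_common`). An inverse crossing is defined only on special labels. The
full twist of a braid is central and is a multiple of every crossing, so a list of labels that is a
$k$-fold full twist allows $k$ successive inverse crossings. Deep trees with sufficiently twisted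
labels thus lie in the domain of any given operator. -/

namespace GeomGroup

open scoped Quandles

/-! ### The group `B_•` and its shift endomorphism -/

/-- The defining relations of `B_•` for two sequences of elements of a monoid. -/
structure BFamily {M : Type*} [Monoid M] (a σ : ℕ → M) : Prop where
  aa : ∀ i k, a i * a (i + 1 + k) = a (i + 2 + k) * a i
  aσ : ∀ i k, a i * σ (i + 1 + k) = σ (i + 2 + k) * a i
  σa : ∀ i k, σ i * a (i + 2 + k) = a (i + 2 + k) * σ i
  σσ : ∀ i k, σ i * σ (i + 2 + k) = σ (i + 2 + k) * σ i
  braid : ∀ i, σ i * σ (i + 1) * σ i = σ (i + 1) * σ i * σ (i + 1)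
  mixed₁ : ∀ i, σ (i + 1) * σ i * a (i + 1) = a i * σ i
  mixed₂ : ∀ i, σ i * σ (i + 1) * a i = a (i + 1) * σ i

/-- The generator `a` of `B_•`. -/
def bA (i : ℕ) : BBullet := PresentedGroup.of (BGen.a i)

/-- The generator `σ` of `B_•`. -/
def bS (i : ℕ) : BBullet := PresentedGroup.of (BGen.σ i)

theorem bFamily : BFamily bA bS := by
  have key : ∀ u v : FreeGroup BGen, BRel (u * v⁻¹) →
      PresentedGroup.mk {w | BRel w} u = PresentedGroup.mk {w | BRel w} v := fun u v h => by
    rw [← mul_inv_eq_one, ← map_inv, ← map_mul]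
    exact PresentedGroup.one_of_mem h
  refine ⟨fun i k => ?_, fun i k => ?_, fun i k => ?_, fun i k => ?_, fun i => ?_, fun i => ?_,
    fun i => ?_⟩
  · have := BRel.aa i (i + 2 + k) (by omega)
    -- Writing $j=i+2+k$ removes the truncated subtraction in the relator.
    rw [show i + 2 + k - 1 = i + 1 + k by omega] at this
    exact key _ _ this
  · have := BRel.aσ i (i + 2 + k) (by omega)
    rw [show i + 2 + k - 1 = i + 1 + k by omega] at this
    exact key _ _ this
  · exact key _ _ (BRel.σa i (i + 2 + k) (by omega))
  · exact key _ _ (BRel.σσ i (i + 2 + k) (by omega))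
  · exact key _ _ (BRel.braid i)
  · exact key _ _ (BRel.mixed₁ i)
  · exact key _ _ (BRel.mixed₂ i)

/-- The assignment on generators given by two sequences. -/
def genMap {G : Type*} (a σ : ℕ → G) : BGen → G
  | BGen.a i => a i
  | BGen.σ i => σ i

theorem BFamily.rels {G : Type*} [Group G] {a σ : ℕ → G} (h : BFamily a σ) :
    ∀ r ∈ {w : FreeGroup BGen | BRel w}, FreeGroup.lift (genMap a σ) r = 1 := by
  rintro r hr
  cases hr with
  | aa i j hj =>
    obtain ⟨k, rfl⟩ := Nat.exists_eq_add_of_le hj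
    rw [show i + 2 + k - 1 = i + 1 + k by omega]
    rw [map_mul, map_inv, mul_inv_eq_one]
    simpa [ga, gσ, genMap] using h.aa i k
  | aσ i j hj =>
    obtain ⟨k, rfl⟩ := Nat.exists_eq_add_of_le hj
    rw [show i + 2 + k - 1 = i + 1 + k by omega]
    rw [map_mul, map_inv, mul_inv_eq_one]
    simpa [ga, gσ, genMap] using h.aσ i k
  | σa i j hj =>
    obtain ⟨k, rfl⟩ := Nat.exists_eq_add_of_le hj
    rw [map_mul, map_inv, mul_inv_eq_one]
    simpa [ga, gσ, genMap] using h.σa i k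
  | σσ i j hj =>
    obtain ⟨k, rfl⟩ := Nat.exists_eq_add_of_le hj
    rw [map_mul, map_inv, mul_inv_eq_one]
    simpa [ga, gσ, genMap] using h.σσ i k
  | braid i =>
    rw [map_mul, map_inv, mul_inv_eq_one]
    simpa [ga, gσ, genMap] using h.braid i
  | mixed₁ i =>
    rw [map_mul, map_inv, mul_inv_eq_one]
    simpa [ga, gσ, genMap] using h.mixed₁ i
  | mixed₂ i =>
    rw [map_mul, map_inv, mul_inv_eq_one]
    simpa [ga, gσ, genMap] using h.mixed₂ i

/-- The homomorphism out of `B_•` given by a family satisfying its relations. -/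
def BFamily.lift {G : Type*} [Group G] {a σ : ℕ → G} (h : BFamily a σ) : BBullet →* G :=
  PresentedGroup.toGroup h.rels

@[simp] theorem BFamily.lift_bA {G : Type*} [Group G] {a σ : ℕ → G} (h : BFamily a σ) (i : ℕ) :
    h.lift (bA i) = a i := PresentedGroup.toGroup.of h.rels

@[simp] theorem BFamily.lift_bS {G : Type*} [Group G] {a σ : ℕ → G} (h : BFamily a σ) (i : ℕ) :
    h.lift (bS i) = σ i := PresentedGroup.toGroup.of h.rels

theorem BBullet.induction {p : BBullet → Prop} (one : p 1) (a : ∀ i, p (bA i))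
    (σ : ∀ i, p (bS i)) (mul : ∀ x y, p x → p y → p (x * y)) (inv : ∀ x, p x → p x⁻¹)
    (x : BBullet) : p x := by
  obtain ⟨w, rfl⟩ := PresentedGroup.mk_surjective _ x
  induction w using FreeGroup.induction_on with
  | C1 => exact one
  | of g => cases g with
    | a i => exact a i
    | σ i => exact σ i
  | inv_of g _ => cases g with
    | a i => exact inv _ (a i)
    | σ i => exact inv _ (σ i)
  | mul x y hx hy => rw [map_mul]; exact mul _ _ hx hy

/-- Two homomorphisms out of `B_•` into a monoid agree if they agree on generators. -/
theorem BBullet.hom_ext {M : Type*} [Monoid M] {f g : BBullet →* M}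
    (ha : ∀ i, f (bA i) = g (bA i)) (hσ : ∀ i, f (bS i) = g (bS i)) : f = g := by
  ext x
  induction x using BBullet.induction with
  | one => simp
  | a i => exact ha i
  | σ i => exact hσ i
  | mul x y hx hy => simp [hx, hy]
  | inv x hx =>
    have h1 : f x⁻¹ * f x = 1 := by rw [← map_mul]; simp
    have h2 : g x * g x⁻¹ = 1 := by rw [← map_mul]; simp
    rw [← hx] at h2
    exact left_inv_eq_right_inv h1 h2

theorem bFamily_succ : BFamily (fun i => bA (i + 1)) (fun i => bS (i + 1)) := by
  have e : ∀ i k n : ℕ, i + n + k + 1 = i + 1 + n + k := fun i k n => by omega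
  constructor
  · intro i k; simpa only [e] using bFamily.aa (i + 1) k
  · intro i k; simpa only [e] using bFamily.aσ (i + 1) k
  · intro i k; simpa only [e] using bFamily.σa (i + 1) k
  · intro i k; simpa only [e] using bFamily.σσ (i + 1) k
  · intro i; exact bFamily.braid (i + 1)
  · intro i; exact bFamily.mixed₁ (i + 1)
  · intro i; exact bFamily.mixed₂ (i + 1)

/-- The shift endomorphism of `B_•`, mapping `a i` to `a (i + 1)` and `σ i` to `σ (i + 1)`. -/
def sh : BBullet →* BBullet := bFamily_succ.lift

@[simp] theorem sh_bA (i : ℕ) : sh (bA i) = bA (i + 1) := bFamily_succ.lift_bA i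

@[simp] theorem sh_bS (i : ℕ) : sh (bS i) = bS (i + 1) := bFamily_succ.lift_bS i

/-- The relations with $i=0$, $j\ge 2$ say this for generators, and the identity is stable under
products and inverses. With `bS_mul_sh` it condenses the infinite families of relations into two. -/
theorem bA_mul_sh (x : BBullet) : bA 0 * sh x = sh (sh x) * bA 0 := by
  induction x using BBullet.induction with
  | one => simp
  | a i => simpa [add_comm, add_left_comm] using bFamily.aa 0 i
  | σ i => simpa [add_comm, add_left_comm] using bFamily.aσ 0 i
  | mul x y hx hy => simp only [map_mul]; rw [← mul_assoc, hx, mul_assoc, hy, mul_assoc]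
  | inv x hx =>
    simp only [map_inv]
    rw [mul_inv_eq_iff_eq_mul, mul_assoc, hx, inv_mul_cancel_left]

theorem bS_mul_sh (x : BBullet) : bS 0 * sh (sh x) = sh (sh x) * bS 0 := by
  induction x using BBullet.induction with
  | one => simp
  | a i => simpa [add_comm, add_left_comm] using bFamily.σa 0 i
  | σ i => simpa [add_comm, add_left_comm] using bFamily.σσ 0 i
  | mul x y hx hy => simp only [map_mul]; rw [← mul_assoc, hx, mul_assoc, hy, mul_assoc]
  | inv x hx =>
    simp only [map_inv]
    rw [mul_inv_eq_iff_eq_mul, mul_assoc, hx, inv_mul_cancel_left]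

theorem bS_braid : bS 0 * bS 1 * bS 0 = bS 1 * bS 0 * bS 1 := bFamily.braid 0

theorem bS_mixed₁ : bS 1 * bS 0 * bA 1 = bA 0 * bS 0 := bFamily.mixed₁ 0

theorem bS_mixed₂ : bS 0 * bS 1 * bA 0 = bA 1 * bS 0 := bFamily.mixed₂ 0

@[simp] theorem sh_iterate_bA (n i : ℕ) : sh^[n] (bA i) = bA (i + n) := by
  induction n with
  | zero => rfl
  | succ n ih => rw [Function.iterate_succ_apply', ih, sh_bA]; rfl

@[simp] theorem sh_iterate_bS (n i : ℕ) : sh^[n] (bS i) = bS (i + n) := by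
  induction n with
  | zero => rfl
  | succ n ih => rw [Function.iterate_succ_apply', ih, sh_bS]; rfl

/-- Families obtained from two elements by iterating an endomorphism. -/
theorem BFamily.of_shift {M : Type*} [Monoid M] (s : M →* M) (a σ : M)
    (h₁ : ∀ y, a * s y = s (s y) * a) (h₂ : ∀ y, σ * s (s y) = s (s y) * σ)
    (braid : σ * s σ * σ = s σ * σ * s σ) (mixed₁ : s σ * σ * s a = a * σ)
    (mixed₂ : σ * s σ * a = s a * σ) :
    BFamily (fun i => s^[i] a) (fun i => s^[i] σ) := by
  have e : ∀ i k n x, s^[i + n + k] x = s^[i] (s^[n] (s^[k] x)) := fun i k n x => by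
    rw [add_assoc, Function.iterate_add_apply, Function.iterate_add_apply]
  have e' : ∀ i x, s^[i + 1] x = s^[i] (s x) := fun i x => Function.iterate_succ_apply _ _ _
  have m : ∀ i x y, s^[i] (x * y) = s^[i] x * s^[i] y := fun i x y => iterate_map_mul s i x y
  constructor
  -- Every relation of index $i$ is the image under $s^i$ of one of index $0$; the braid and mixed
  -- ones are then hypotheses.
  all_goals intros; simp only [e, e', ← m]; congr 1
  · exact h₁ _
  · exact h₁ _
  · exact h₂ _
  · exact h₂ _

/-! ### Injectivity of the shift

We let `B_•` act on sequences of slots, some of which are declared empty, and record the element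
of `B_•` that is left when the empty slots are deleted. -/

/-- Self-maps of sequences of slots together with an element of `B_•` for each sequence. -/
def Cocycle (C : Type u) : Type u := Stream' C → Stream' C × BBullet

namespace Cocycle

variable {C : Type u}

@[ext] theorem ext {F G : Cocycle C} (h : ∀ s, F s = G s) : F = G := funext h

instance : Monoid (Cocycle C) where
  mul F G := fun s => ((G (F s).1).1, (F s).2 * (G (F s).1).2)
  one := fun s => (s, 1)
  mul_assoc F G H := by
    funext s
    exact Prod.ext rfl (mul_assoc _ _ _)
  one_mul F := by
    funext s
    exact Prod.ext rfl (one_mul _)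
  mul_one F := by
    funext s
    exact Prod.ext rfl (mul_one _)

theorem mul_apply (F G : Cocycle C) (s : Stream' C) :
    (F * G) s = ((G (F s).1).1, (F s).2 * (G (F s).1).2) := rfl

theorem one_apply (s : Stream' C) : (1 : Cocycle C) s = (s, 1) := rfl

/-- Acting on the sequence from the second slot on. -/
def shift (ne : C → Bool) : Cocycle C →* Cocycle C where
  toFun F := fun s => (Stream'.cons s.head (F s.tail).1, bif ne s.head then sh (F s.tail).2
    else (F s.tail).2)
  map_one' := by
    refine funext fun s => Prod.ext (Stream'.eta s) ?_
    change (bif ne s.head then sh 1 else 1) = 1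
    cases ne s.head <;> simp
  map_mul' F G := by
    refine funext fun s => Prod.ext rfl ?_
    change (bif ne s.head then sh ((F s.tail).2 * (G (F s.tail).1).2)
        else (F s.tail).2 * (G (F s.tail).1).2) =
      (bif ne s.head then sh (F s.tail).2 else (F s.tail).2) *
        (bif ne s.head then sh (G (F s.tail).1).2 else (G (F s.tail).1).2)
    cases ne s.head <;> simp

theorem shift_cons (ne : C → Bool) (F : Cocycle C) (c : C) (s : Stream' C) :
    shift ne F (Stream'.cons c s) =
      (Stream'.cons c (F s).1, bif ne c then sh (F s).2 else (F s).2) := rfl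

theorem ext_cons₂ {F G : Cocycle C}
    (h : ∀ c d s, F (Stream'.cons c (Stream'.cons d s)) = G (Stream'.cons c (Stream'.cons d s))) :
    F = G := by
  ext1 s
  rw [← Stream'.eta s, ← Stream'.eta s.tail]
  exact h _ _ _

theorem ext_cons₃ {F G : Cocycle C}
    (h : ∀ c d e s, F (Stream'.cons c (Stream'.cons d (Stream'.cons e s))) =
      G (Stream'.cons c (Stream'.cons d (Stream'.cons e s)))) :
    F = G := by
  refine ext_cons₂ fun c d s => ?_
  rw [← Stream'.eta s]
  exact h _ _ _ _

/-- Merging the first two slots. -/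
def mergeFun (m : C × C ≃ C) (ne : C → Bool) : Cocycle C := fun s =>
  (Stream'.cons (m (s.head, s.tail.head)) s.tail.tail,
    bif ne s.head && ne s.tail.head then bA 0 else 1)

/-- Splitting the first slot. -/
def splitFun (m : C × C ≃ C) (ne : C → Bool) : Cocycle C := fun s =>
  (Stream'.cons (m.symm s.head).1 (Stream'.cons (m.symm s.head).2 s.tail),
    bif ne (m.symm s.head).1 && ne (m.symm s.head).2 then (bA 0)⁻¹ else 1)

/-- Exchanging the first two slots, with value `x` if both are nonempty. -/
def swapFun (ne : C → Bool) (x : BBullet) : Cocycle C := fun s =>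
  (Stream'.cons s.tail.head (Stream'.cons s.head s.tail.tail),
    bif ne s.head && ne s.tail.head then x else 1)

theorem mergeFun_cons (m : C × C ≃ C) (ne : C → Bool) (c d : C) (s : Stream' C) :
    mergeFun m ne (Stream'.cons c (Stream'.cons d s)) =
      (Stream'.cons (m (c, d)) s, bif ne c && ne d then bA 0 else 1) := rfl

theorem splitFun_cons (m : C × C ≃ C) (ne : C → Bool) (c : C) (s : Stream' C) :
    splitFun m ne (Stream'.cons c s) =
      (Stream'.cons (m.symm c).1 (Stream'.cons (m.symm c).2 s),
        bif ne (m.symm c).1 && ne (m.symm c).2 then (bA 0)⁻¹ else 1) := rfl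

theorem swapFun_cons (ne : C → Bool) (x : BBullet) (c d : C) (s : Stream' C) :
    swapFun ne x (Stream'.cons c (Stream'.cons d s)) =
      (Stream'.cons d (Stream'.cons c s), bif ne c && ne d then x else 1) := rfl

theorem swapFun_mul (ne : C → Bool) (x y : BBullet) (h : x * y = 1) :
    swapFun ne x * swapFun ne y = 1 := by
  refine ext_cons₂ fun c d s => ?_
  simp only [mul_apply, one_apply, swapFun_cons]
  cases ne c <;> cases ne d <;> simp [h]

/-- Merging the first two slots, as a unit. -/
def merge (m : C × C ≃ C) (ne : C → Bool) : (Cocycle C)ˣ where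
  val := mergeFun m ne
  inv := splitFun m ne
  val_inv := by
    refine ext_cons₂ fun c d s => ?_
    simp only [mul_apply, one_apply, mergeFun_cons, splitFun_cons, Equiv.symm_apply_apply]
    cases ne c <;> cases ne d <;> simp
  inv_val := by
    refine ext_cons₂ fun c d s => ?_
    simp only [mul_apply, one_apply, mergeFun_cons, splitFun_cons, Prod.mk.eta,
      Equiv.apply_symm_apply]
    cases ne (m.symm c).1 <;> cases ne (m.symm c).2 <;> simp

/-- Exchanging the first two slots, as a unit. -/
def swap (ne : C → Bool) : (Cocycle C)ˣ where
  val := swapFun ne (bS 0)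
  inv := swapFun ne (bS 0)⁻¹
  val_inv := swapFun_mul ne _ _ (mul_inv_cancel _)
  inv_val := swapFun_mul ne _ _ (inv_mul_cancel _)

theorem merge_cons (m : C × C ≃ C) (ne : C → Bool) (c d : C) (s : Stream' C) :
    (merge m ne).val (Stream'.cons c (Stream'.cons d s)) =
      (Stream'.cons (m (c, d)) s, bif ne c && ne d then bA 0 else 1) := rfl

theorem swap_cons (ne : C → Bool) (c d : C) (s : Stream' C) :
    (swap ne).val (Stream'.cons c (Stream'.cons d s)) =
      (Stream'.cons d (Stream'.cons c s), bif ne c && ne d then bS 0 else 1) := rfl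

/-- After deletion of empty slots, each relation either persists or degenerates to a trivial
identity; `hm` says that a merged slot is empty exactly when both of its parts are. -/
theorem bFamily (m : C × C ≃ C) (ne : C → Bool) (hm : ∀ c d, ne (m (c, d)) = (ne c || ne d)) :
    BFamily (fun i => (shift ne)^[i] (merge m ne).val) (fun i => (shift ne)^[i] (swap ne).val) := by
  apply BFamily.of_shift
  · intro y
    refine ext_cons₂ fun c d s => ?_
    simp only [mul_apply, merge_cons, shift_cons, hm]
    cases ne c <;> cases ne d <;> simp [bA_mul_sh]
  · intro y
    refine ext_cons₂ fun c d s => ?_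
    simp only [mul_apply, swap_cons, shift_cons]
    cases ne c <;> cases ne d <;> simp [bS_mul_sh]
  · refine ext_cons₃ fun c d e s => ?_
    simp only [mul_apply, swap_cons, shift_cons]
    cases ne c <;> cases ne d <;> cases ne e <;> simp [bS_braid]
  · refine ext_cons₃ fun c d e s => ?_
    simp only [mul_apply, swap_cons, merge_cons, shift_cons, hm]
    cases ne c <;> cases ne d <;> cases ne e <;> simp [bS_mixed₁]
  · refine ext_cons₃ fun c d e s => ?_
    simp only [mul_apply, swap_cons, merge_cons, shift_cons, hm]
    cases ne c <;> cases ne d <;> cases ne e <;> simp [bS_mixed₂]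

end Cocycle

theorem BFamily.units {M : Type*} [Monoid M] {a σ : ℕ → Mˣ}
    (h : BFamily (fun i => (a i : M)) (fun i => (σ i : M))) : BFamily a σ := by
  constructor
  all_goals intros; ext; push_cast
  · exact h.aa _ _
  · exact h.aσ _ _
  · exact h.σa _ _
  · exact h.σσ _ _
  · exact h.braid _
  · exact h.mixed₁ _
  · exact h.mixed₂ _

theorem coe_iterate_unitsMap {M : Type*} [Monoid M] (s : M →* M) (i : ℕ) (x : Mˣ) :
    (((Units.map s)^[i] x : Mˣ) : M) = s^[i] (x : M) := by
  induction i with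
  | zero => rfl
  | succ i ih => simp only [Function.iterate_succ_apply', Units.coe_map, ih]

/-- If the first slot is empty, deleting it turns the action of `sh x` into that of `x`, so `x` can
be read off from `sh x`. -/
theorem sh_injective : Function.Injective sh := by
  -- Slots are subsets of $\mathbb N$, and merging is disjoint union through $\mathbb N\sqcup\mathbb
  -- N\simeq\mathbb N$. This is a bijection $C\times C\simeq C$ that detects emptiness and satisfies
  -- $m(K,K)=K$ for the full set $K$.
  let C := ℕ → Bool
  let m : C × C ≃ C := (Equiv.sumArrowEquivProdArrow ℕ ℕ Bool).symm.trans
    (Equiv.natSumNatEquivNat.arrowCongr (Equiv.refl Bool))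
  classical
  let ne : C → Bool := fun f => decide (∃ n, f n = true)
  have hm : ∀ c d, ne (m (c, d)) = (ne c || ne d) := by
    intro c d
    have h : ∀ n, m (c, d) n = Sum.elim c d (Equiv.natSumNatEquivNat.symm n) := fun n => rfl
    simp only [ne, h, ← Bool.decide_or, decide_eq_decide]
    rw [Equiv.natSumNatEquivNat.symm.exists_congr_left (p := fun n =>
      Sum.elim c d (Equiv.natSumNatEquivNat.symm n) = true)]
    simp
  let K : C := fun _ => true
  let Z : C := fun _ => false
  have hK : ne K = true := by simp [ne, K]
  have hZ : ne Z = false := by simp [ne, Z]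
  have hKK : m (K, K) = K := by
    funext n
    change Sum.elim K K (Equiv.natSumNatEquivNat.symm n) = true
    cases Equiv.natSumNatEquivNat.symm n <;> rfl
  let S := Cocycle.shift ne
  let a : ℕ → (Cocycle C)ˣ := fun i => (Units.map S)^[i] (Cocycle.merge m ne)
  let σ : ℕ → (Cocycle C)ˣ := fun i => (Units.map S)^[i] (Cocycle.swap ne)
  have hf : BFamily a σ := by
    apply BFamily.units
    simp only [a, σ, coe_iterate_unitsMap]
    exact Cocycle.bFamily m ne hm
  have e : (hf.lift.comp sh) = (Units.map S).comp hf.lift := by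
    apply BBullet.hom_ext
    · intro i; simp [a, Function.iterate_succ_apply']
    · intro i; simp [σ, Function.iterate_succ_apply']
  -- Nothing is deleted from the constant sequence $K$, which is fixed, so the recorded element is
  -- `x` itself.
  have key : ∀ x, (hf.lift x).val (Stream'.const K) = (Stream'.const K, x) := by
    have hS : ∀ F x, F (Stream'.const K) = (Stream'.const K, x) →
        S F (Stream'.const K) = (Stream'.const K, sh x) := by
      intro F x h
      conv_lhs => rw [Stream'.const_eq, Cocycle.shift_cons, h, hK, ← Stream'.const_eq]
      rfl
    intro x
    induction x using BBullet.induction with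
    | one => simp [Cocycle.one_apply]
    | a i =>
      rw [hf.lift_bA]
      simp only [a, coe_iterate_unitsMap]
      induction i with
      | zero =>
        change (Cocycle.merge m ne).val _ = _
        conv_lhs => rw [Stream'.const_eq, Stream'.const_eq]
        rw [Cocycle.merge_cons, hKK, hK]
        simp only [← Stream'.const_eq]
        rfl
      | succ i ih => rw [Function.iterate_succ_apply', hS _ _ ih, sh_bA]
    | σ i =>
      rw [hf.lift_bS]
      simp only [σ, coe_iterate_unitsMap]
      induction i with
      | zero =>
        change (Cocycle.swap ne).val _ = _
        conv_lhs => rw [Stream'.const_eq, Stream'.const_eq]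
        rw [Cocycle.swap_cons, hK]
        simp only [← Stream'.const_eq]
        rfl
      | succ i ih => rw [Function.iterate_succ_apply', hS _ _ ih, sh_bS]
    | mul x y hx hy => rw [map_mul, Units.val_mul, Cocycle.mul_apply, hx, hy]
    | inv x hx =>
      have h : (hf.lift (x * x⁻¹)).val (Stream'.const K) = (Stream'.const K, 1) := by
        simp [Cocycle.one_apply]
      rw [map_mul, Units.val_mul, Cocycle.mul_apply, hx, Prod.ext_iff] at h
      exact Prod.ext h.1 (eq_inv_of_mul_eq_one_right h.2)
  rw [injective_iff_map_eq_one]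
  intro x hx
  have h1 : (hf.lift (sh x)).val (Stream'.cons Z (Stream'.const K)) =
      (Stream'.cons Z (Stream'.const K), x) := by
    rw [← MonoidHom.comp_apply, e, MonoidHom.comp_apply, Units.coe_map]
    change Cocycle.shift ne _ _ = _
    rw [Cocycle.shift_cons, key, hZ]
    rfl
  rw [hx, map_one] at h1
  exact (Prod.ext_iff.1 h1).2.symm

/-! ### The half twist on lists of labels -/

/-- A list of given length splits into blocks of prescribed lengths. -/
theorem exists_blocks {L : Type u} (l : List L) (a b c d : ℕ) (h : l.length = a + b + c + d) :
    ∃ u v w z : List L, l = u ++ v ++ w ++ z ∧ u.length = a ∧ v.length = b ∧ w.length = c ∧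
      z.length = d := by
  refine ⟨l.take a, (l.drop a).take b, ((l.drop a).drop b).take c, ((l.drop a).drop b).drop c,
    by simp only [List.append_assoc, List.take_append_drop], ?_, ?_, ?_, ?_⟩ <;> simp <;> omega

theorem blocks_inj {L : Type u} {u v w z u' v' w' z' : List L} (h : u ++ v ++ w ++ z = u' ++ v' ++ w' ++ z')
    (h1 : u.length = u'.length) (h2 : v.length = v'.length) (h3 : w.length = w'.length) :
    u = u' ∧ v = v' ∧ w = w' ∧ z = z' := by
  simp only [List.append_assoc] at h
  obtain ⟨e1, h⟩ := List.append_inj h h1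
  obtain ⟨e2, h⟩ := List.append_inj h h2
  obtain ⟨e3, h⟩ := List.append_inj h h3
  exact ⟨e1, e2, e3, h⟩

section Lists

variable {L : Type u} [Shelf L]

/-- The action `y ↦ x₁[x₂[… xₙ[y] …]]` of a list of labels. -/
def lact (l : List L) (y : L) : L := l.foldr (fun x z => x ◃ z) y

@[simp] theorem lact_cons (x : L) (l : List L) (y : L) : lact (x :: l) y = x ◃ lact l y := rfl

theorem lact_append (u v : List L) (y : L) : lact (u ++ v) y = lact u (lact v y) :=
  List.foldr_append

theorem lact_act (l : List L) (x y : L) : lact l (x ◃ y) = lact l x ◃ lact l y := by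
  induction l with
  | nil => rfl
  | cons z l ih => rw [lact_cons, ih, Shelf.self_distrib]; rfl

/-- By self-distributivity `lact u` is an endomorphism, so it transports the action of `v` to that
of its image. This is the block form of the LD law. -/
theorem lact_map_lact (u v : List L) (y : L) :
    lact (v.map (lact u)) (lact u y) = lact u (lact v y) := by
  induction v with
  | nil => rfl
  | cons x v ih => rw [List.map_cons, lact_cons, ih, lact_cons, lact_act]

theorem map_lact_map (u v w : List L) :
    (w.map (lact u)).map (lact (v.map (lact u))) = (w.map (lact v)).map (lact u) := by
  simp only [List.map_map]
  exact List.map_congr_left fun y _ => lact_map_lact u v y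

theorem map_lact_append (u v w : List L) :
    w.map (lact (u ++ v)) = (w.map (lact v)).map (lact u) := by
  rw [List.map_map]
  exact List.map_congr_left fun y _ => lact_append u v y

/-- The half twist. -/
def halfTwist : List L → List L
  | [] => []
  | x :: l => (halfTwist l).map (fun y => x ◃ y) ++ [x]

@[simp] theorem length_halfTwist (l : List L) : (halfTwist l).length = l.length := by
  induction l with
  | nil => rfl
  | cons x l ih => simp [halfTwist, ih]

theorem halfTwist_append (u v : List L) :
    halfTwist (u ++ v) = (halfTwist v).map (lact u) ++ halfTwist u := by
  induction u with
  | nil => simp [halfTwist, show lact ([] : List L) = id from rfl]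
  | cons x u ih => simp [halfTwist, ih, Function.comp_def]

theorem halfTwist_map_lact (u l : List L) :
    halfTwist (l.map (lact u)) = (halfTwist l).map (lact u) := by
  induction l with
  | nil => rfl
  | cons x l ih => simp [halfTwist, ih, Function.comp_def, lact_act]

/-- A crossing replaces $x,y$ by $x[y],x$, and $x[y][x[z]]=x[y[z]]$ says that the composite action
does not change. -/
theorem lact_halfTwist (l : List L) (y : L) : lact (halfTwist l) y = lact l y := by
  induction l generalizing y with
  | nil => rfl
  | cons x l ih =>
    have := lact_map_lact [x] (halfTwist l) y
    rw [halfTwist, lact_append]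
    exact this.trans (congrArg _ (ih y))

theorem halfTwist_injective (hL : ∀ x : L, Function.Injective (fun y : L => x ◃ y)) :
    Function.Injective (halfTwist : List L → List L) := by
  intro l
  induction l with
  | nil =>
    intro l' h
    have := congrArg List.length h
    simp only [length_halfTwist] at this
    exact (List.length_eq_zero_iff.1 this.symm).symm
  | cons x l ih =>
    intro l' h
    cases l' with
    | nil => simpa using congrArg List.length h
    | cons x' l' =>
      simp only [halfTwist] at h
      obtain ⟨h1, h2⟩ := List.append_inj' h rfl
      obtain rfl : x = x' := by simpa using h2
      rw [ih (List.map_injective_iff.2 (hL x) h1)]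

/-- The full twist. -/
def fullTwist (l : List L) : List L := halfTwist (halfTwist l)

@[simp] theorem length_fullTwist (l : List L) : (fullTwist l).length = l.length := by
  simp [fullTwist]

theorem fullTwist_injective (hL : ∀ x : L, Function.Injective (fun y : L => x ◃ y)) :
    Function.Injective (fullTwist : List L → List L) :=
  (halfTwist_injective hL).comp (halfTwist_injective hL)

/-- The positive crossing of the two middle blocks commutes with the half twist. -/
theorem halfTwist_cross (u v w z : List L) :
    ∃ u' v' w' z' : List L, u'.length = u.length ∧ v'.length = v.length ∧
      w'.length = w.length ∧ z'.length = z.length ∧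
      halfTwist (u ++ v ++ w ++ z) = z' ++ w' ++ v' ++ u' ∧
      halfTwist (u ++ w.map (lact v) ++ v ++ z) = z' ++ v'.map (lact w') ++ w' ++ u' := by
  refine ⟨halfTwist u, (halfTwist v).map (lact u), ((halfTwist w).map (lact v)).map (lact u),
    (((halfTwist z).map (lact w)).map (lact v)).map (lact u), by simp, by simp, by simp, by simp,
    by simp only [halfTwist_append, List.map_append, List.append_assoc], ?_⟩
  -- A crossing before the half twist becomes a crossing of the reversed blocks after it; equality
  -- of labels rests on the invariance of the action under the half twist.
  have h : ((halfTwist v).map (lact u)).map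
      (lact (((halfTwist w).map (lact v)).map (lact u))) =
      ((halfTwist v).map (lact (w.map (lact v)))).map (lact u) := by
    rw [map_lact_map]
    congr 1
    refine List.map_congr_left fun y _ => ?_
    rw [← halfTwist_map_lact, lact_halfTwist]
  simp only [h, halfTwist_append, List.map_append, List.append_assoc, halfTwist_map_lact,
    map_lact_map]

/-- The half twist is a multiple of the positive crossing of the two middle blocks. -/
theorem halfTwist_eq_cross (u v w z : List L) :
    ∃ u' v' w' z' : List L, u'.length = u.length ∧ v'.length = v.length ∧
      w'.length = w.length ∧ z'.length = z.length ∧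
      halfTwist (u ++ v ++ w ++ z) = z' ++ w'.map (lact v') ++ v' ++ u' := by
  refine ⟨halfTwist u, (halfTwist v).map (lact u), (halfTwist w).map (lact u),
    (((halfTwist z).map (lact w)).map (lact v)).map (lact u), by simp, by simp, by simp, by simp,
    ?_⟩
  have h : (halfTwist w).map (lact (halfTwist v)) = (halfTwist w).map (lact v) :=
    List.map_congr_left fun y _ => lact_halfTwist v y
  simp only [halfTwist_append, List.map_append, List.append_assoc, map_lact_map, h]

theorem fullTwist_cross (u v w z : List L) :
    ∃ u' v' w' z' : List L, u'.length = u.length ∧ v'.length = v.length ∧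
      w'.length = w.length ∧ z'.length = z.length ∧
      fullTwist (u ++ v ++ w ++ z) = u' ++ v' ++ w' ++ z' ∧
      fullTwist (u ++ w.map (lact v) ++ v ++ z) = u' ++ w'.map (lact v') ++ v' ++ z' := by
  obtain ⟨u', v', w', z', h1, h2, h3, h4, h5, h6⟩ := halfTwist_cross u v w z
  obtain ⟨z'', w'', v'', u'', k1, k2, k3, k4, k5, k6⟩ := halfTwist_cross z' w' v' u'
  exact ⟨u'', v'', w'', z'', by omega, by omega, by omega, by omega, by rw [fullTwist, h5, k5],
    by rw [fullTwist, h6, k6]⟩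

/-- The full twist is a multiple of the positive crossing of the two middle blocks. -/
theorem fullTwist_eq_cross (u v w z : List L) :
    ∃ u' v' w' z' : List L, u'.length = u.length ∧ v'.length = w.length ∧
      w'.length = v.length ∧ z'.length = z.length ∧
      fullTwist (u ++ v ++ w ++ z) = u' ++ w'.map (lact v') ++ v' ++ z' := by
  obtain ⟨u', v', w', z', h1, h2, h3, h4, h5⟩ := halfTwist_eq_cross u v w z
  obtain ⟨z'', v'', w'', u'', k1, k2, k3, k4, k5, k6⟩ := halfTwist_cross z' v' w' u'
  exact ⟨u'', w'', v'', z'', by omega, by omega, by omega, by omega, by rw [fullTwist, h5, k6]⟩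

theorem iterate_fullTwist_cross (k : ℕ) (u v w z : List L) :
    ∃ u' v' w' z' : List L, u'.length = u.length ∧ v'.length = v.length ∧
      w'.length = w.length ∧ z'.length = z.length ∧
      fullTwist^[k] (u ++ v ++ w ++ z) = u' ++ v' ++ w' ++ z' ∧
      fullTwist^[k] (u ++ w.map (lact v) ++ v ++ z) = u' ++ w'.map (lact v') ++ v' ++ z' := by
  induction k generalizing u v w z with
  | zero => exact ⟨u, v, w, z, rfl, rfl, rfl, rfl, rfl, rfl⟩
  | succ k ih =>
    obtain ⟨u', v', w', z', h1, h2, h3, h4, h5, h6⟩ := fullTwist_cross u v w z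
    obtain ⟨u'', v'', w'', z'', k1, k2, k3, k4, k5, k6⟩ := ih u' v' w' z'
    exact ⟨u'', v'', w'', z'', by omega, by omega, by omega, by omega,
      by rw [Function.iterate_succ_apply, h5, k5], by rw [Function.iterate_succ_apply, h6, k6]⟩

/-- The list is a `k`-fold full twist. -/
def IsTwist (k : ℕ) (l : List L) : Prop := ∃ l₀, l = fullTwist^[k] l₀

theorem length_iterate_fullTwist (k : ℕ) (l : List L) : (fullTwist^[k] l).length = l.length := by
  induction k with
  | zero => rfl
  | succ k ih => rw [Function.iterate_succ_apply', length_fullTwist, ih]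

theorem IsTwist.of_succ {k : ℕ} {l : List L} (h : IsTwist (k + 1) l) : IsTwist k l := by
  obtain ⟨l₀, rfl⟩ := h
  exact ⟨fullTwist l₀, Function.iterate_succ_apply _ _ _⟩

/-- The full twist commutes with crossings, so the crossing can be performed on the untwisted list,
cut into blocks of the same lengths. -/
theorem IsTwist.cross {k : ℕ} {u v w z : List L} (h : IsTwist k (u ++ v ++ w ++ z)) :
    IsTwist k (u ++ w.map (lact v) ++ v ++ z) := by
  obtain ⟨l₀, h⟩ := h
  obtain ⟨u₀, v₀, w₀, z₀, rfl, a1, a2, a3, a4⟩ := exists_blocks l₀ u.length v.length w.length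
    z.length (by
      have := congrArg List.length h
      rw [length_iterate_fullTwist] at this
      rw [← this]; simp; omega)
  obtain ⟨u', v', w', z', h1, h2, h3, h4, h5, h6⟩ := iterate_fullTwist_cross k u₀ v₀ w₀ z₀
  rw [h5] at h
  obtain ⟨rfl, rfl, rfl, rfl⟩ := blocks_inj h (by omega) (by omega) (by omega)
  exact ⟨_, h6.symm⟩

/-- One of the $k+1$ twists is spent: it factors through the crossing to be undone, and the other
$k$ commute with that crossing. -/
theorem IsTwist.exists_cross {k : ℕ} {u v w z : List L}
    (h : IsTwist (k + 1) (u ++ w ++ v ++ z)) :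
    ∃ w₀, w = w₀.map (lact v) ∧ IsTwist k (u ++ v ++ w₀ ++ z) := by
  obtain ⟨l₀, h⟩ := h
  obtain ⟨u₀, w₀, v₀, z₀, rfl, a1, a2, a3, a4⟩ := exists_blocks l₀ u.length w.length v.length
    z.length (by
      have := congrArg List.length h
      rw [length_iterate_fullTwist] at this
      rw [← this]; simp; omega)
  obtain ⟨u', v', w', z', h1, h2, h3, h4, h5⟩ := fullTwist_eq_cross u₀ w₀ v₀ z₀
  rw [Function.iterate_succ_apply, h5] at h
  obtain ⟨u'', v'', w'', z'', k1, k2, k3, k4, k5, k6⟩ := iterate_fullTwist_cross k u' v' w' z'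
  rw [k6] at h
  obtain ⟨rfl, rfl, rfl, rfl⟩ := blocks_inj h (by omega) (by simp; omega) (by omega)
  exact ⟨w'', rfl, _, k5.symm⟩

end Lists

/-! ### Coloured models of `B_•` -/

@[simp] theorem labels_of {L : Type u} (x : L) : labels (FreeMagma.of x) = [x] := rfl

@[simp] theorem labels_mul {L : Type u} (t₁ t₂ : FreeMagma L) :
    labels (t₁ * t₂) = labels t₁ ++ labels t₂ := rfl

theorem labels_map {L : Type u} {M : Type v} (f : L → M) (t : FreeMagma L) :
    labels (FreeMagma.map f t) = (labels t).map f := by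
  induction t using FreeMagma.recOnMul with
  | ih1 x => rfl
  | ih2 x y hx hy => rw [map_mul, labels_mul, hx, hy, labels_mul, List.map_append]

theorem treeBracket_eq {L : Type u} [Shelf L] (t₁ t₂ : FreeMagma L) :
    treeBracket t₁ t₂ = FreeMagma.map (lact (labels t₁)) t₂ := rfl

@[simp] theorem labels_treeBracket {L : Type u} [Shelf L] (t₁ t₂ : FreeMagma L) :
    labels (treeBracket t₁ t₂) = (labels t₂).map (lact (labels t₁)) := labels_map _ _

/-- A right `B_•`-set `Z` together with a value in `Z` for every sequence of `L`-coloured trees,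
such that `a i` merges two consecutive trees and `σ i` exchanges them. -/
structure Model (L : Type u) [Shelf L] (Z : Type v) where
  act : BBullet → Z → Z
  act_one : ∀ z, act 1 z = z
  act_mul : ∀ x y z, act (x * y) z = act y (act x z)
  val : List (FreeMagma L) → Z
  val_a : ∀ u t₁ t₂ v, act (bA u.length) (val (u ++ t₁ :: t₂ :: v)) = val (u ++ (t₁ * t₂) :: v)
  val_σ : ∀ u t₁ t₂ v, act (bS u.length) (val (u ++ t₁ :: t₂ :: v)) =
    val (u ++ treeBracket t₁ t₂ :: t₁ :: v)

namespace Model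

variable {L : Type u} [Shelf L] {Z : Type v} (J : Model L Z)

theorem act_inv {x : BBullet} {y z : Z} (h : J.act x y = z) : J.act x⁻¹ z = y := by
  rw [← h, ← J.act_mul, mul_inv_cancel, J.act_one]

end Model

/-! ### The bracket on `B_•` -/

/-- The self-distributive operation on `B_•`. -/
def bracket (x y : BBullet) : BBullet := x * sh y * bS 0 * (sh x)⁻¹

theorem bracket_mul_sh (x y : BBullet) : bracket x y * sh x = x * sh y * bS 0 := by
  simp [bracket]

theorem bS_mul_sh_assoc (x w : BBullet) : bS 0 * (sh (sh x) * w) = sh (sh x) * (bS 0 * w) := by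
  rw [← mul_assoc, bS_mul_sh, mul_assoc]

theorem bS_mul_sh_inv_assoc (x w : BBullet) :
    bS 0 * ((sh (sh x))⁻¹ * w) = (sh (sh x))⁻¹ * (bS 0 * w) := by
  rw [← map_inv, ← map_inv, bS_mul_sh_assoc]

theorem bA_mul_sh_assoc (x w : BBullet) : bA 0 * (sh x * w) = sh (sh x) * (bA 0 * w) := by
  rw [← mul_assoc, bA_mul_sh, mul_assoc]

/-- Since $\sigma_1$ commutes with the image of $\mathrm{sh}^2$, everything cancels except the braid
relation. In the same way `bracket_comp` and `comp_bracket` reduce to the second and first mixed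
relations. -/
theorem bracket_self_distrib (x y z : BBullet) :
    bracket x (bracket y z) = bracket (bracket x y) (bracket x z) := by
  have h : ∀ w, bS 0 * (bS 1 * (bS 0 * ((bS 1)⁻¹ * w))) = bS 1 * (bS 0 * w) := fun w => by
    have : bS 0 * bS 1 * bS 0 * (bS 1)⁻¹ = bS 1 * bS 0 := by
      rw [bS_braid, mul_inv_cancel_right]
    simp only [← mul_assoc, this]
  simp only [bracket, map_mul, map_inv, mul_inv_rev, inv_inv, sh_bS, mul_assoc,
    bS_mul_sh_assoc, bS_mul_sh_inv_assoc, inv_mul_cancel_left, zero_add, h]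

theorem bracket_injective (x : BBullet) : Function.Injective (bracket x) := fun y z h => by
  simpa [bracket, sh_injective.eq_iff] using h

/-- The operation on `B_•` that corresponds to merging two trees. -/
def comp (x y : BBullet) : BBullet := x * sh y * bA 0

theorem bracket_comp (x y z : BBullet) :
    bracket x (comp y z) = comp (bracket x y) (bracket x z) := by
  have h : ∀ w, bS 0 * (bS 1 * (bA 0 * w)) = bA 1 * (bS 0 * w) := fun w => by
    simp only [← mul_assoc, bS_mixed₂]
  simp only [bracket, comp, map_mul, map_inv, sh_bS, sh_bA, mul_assoc, bS_mul_sh_assoc,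
    inv_mul_cancel_left, zero_add]
  rw [← h, ← map_inv, bA_mul_sh]
  simp only [map_inv]

theorem comp_bracket (x y z : BBullet) : bracket (comp x y) z = bracket x (bracket y z) := by
  have h : ∀ w, bS 1 * (bS 0 * w) = bA 0 * (bS 0 * ((bA 1)⁻¹ * w)) := fun w => by
    rw [← mul_assoc (bA 0), ← bS_mixed₁]
    simp only [mul_assoc, mul_inv_cancel_left]
  simp only [bracket, comp, map_mul, map_inv, mul_inv_rev, sh_bS, sh_bA, mul_assoc,
    bA_mul_sh_assoc, zero_add]
  rw [← bS_mul_sh_inv_assoc, h]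

/-- A copy of `B_•`, as a left cancellative LD-system. -/
def bSystem : LCSystem.{u} where
  carrier := ULift.{u} BBullet
  shelf :=
    { act := fun x y => ⟨bracket x.down y.down⟩
      self_distrib := congrArg ULift.up (bracket_self_distrib _ _ _) }
  left_cancel x _ _ h := ULift.ext _ _ (bracket_injective x.down (congrArg ULift.down h))

/-- The evaluation in `B_•` of a tree coloured by `B_•`. -/
def evalTree : FreeMagma bSystem.{u}.carrier → BBullet
  | FreeMagma.of x => x.down
  | FreeMagma.mul t₁ t₂ => comp (evalTree t₁) (evalTree t₂)

@[simp] theorem evalTree_mul (t₁ t₂ : FreeMagma bSystem.{u}.carrier) :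
    evalTree (t₁ * t₂) = comp (evalTree t₁) (evalTree t₂) := rfl

theorem evalTree_map (x : bSystem.{u}.carrier) (t : FreeMagma bSystem.{u}.carrier) :
    evalTree (FreeMagma.map (fun y => x ◃ y) t) = bracket x.down (evalTree t) := by
  induction t using FreeMagma.recOnMul with
  | ih1 y => rfl
  | ih2 t₁ t₂ h₁ h₂ => rw [map_mul, evalTree_mul, h₁, h₂, evalTree_mul, bracket_comp]

theorem map_comp_apply {L M N : Type*} (f : M → N) (g : L → M) (t : FreeMagma L) :
    FreeMagma.map f (FreeMagma.map g t) = FreeMagma.map (fun x => f (g x)) t := by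
  induction t using FreeMagma.recOnMul with
  | ih1 y => rfl
  | ih2 t₁ t₂ h₁ h₂ => simp only [map_mul, h₁, h₂]

/-- `comp_bracket` unfolds the left tree into its successive labels, and `bracket_comp` lets each
label act through the right tree. -/
theorem evalTree_treeBracket (t₁ t₂ : FreeMagma bSystem.{u}.carrier) :
    evalTree (treeBracket t₁ t₂) = bracket (evalTree t₁) (evalTree t₂) := by
  induction t₁ using FreeMagma.recOnMul generalizing t₂ with
  | ih1 x => exact evalTree_map x t₂
  | ih2 s t hs ht =>
    have : treeBracket (s * t) t₂ = treeBracket s (treeBracket t t₂) := by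
      simp only [treeBracket_eq, map_comp_apply, labels_mul]
      congr 1
      exact congrArg _ (funext fun y => lact_append _ _ y)
    rw [this, hs, ht, evalTree_mul, comp_bracket]

/-- The evaluation in `B_•` of a sequence of trees coloured by `B_•`. -/
def evalForest : List (FreeMagma bSystem.{u}.carrier) → BBullet
  | [] => 1
  | t :: f => evalTree t * sh (evalForest f)

/-- The model of `B_•` on itself. -/
def bModel : Model bSystem.{u}.carrier (ULift.{u} BBullet) where
  act x z := ⟨z.down * x⟩
  act_one z := ULift.ext _ _ (mul_one z.down)
  act_mul x y z := ULift.ext _ _ (mul_assoc z.down x y).symm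
  val f := ⟨evalForest f⟩
  val_a u t₁ t₂ v := by
    refine congrArg ULift.up ?_
    induction u with
    | nil => simp [evalForest, comp, mul_assoc, bA_mul_sh]
    | cons s u ih =>
      simp only [List.cons_append, evalForest, List.length_cons, ← ih, ← sh_bA, map_mul, mul_assoc]
  val_σ u t₁ t₂ v := by
    refine congrArg ULift.up ?_
    induction u with
    | nil =>
      -- The bracket is designed for this: `bracket x y * sh x = x * sh y * bS 0`, while $\sigma_1$
      -- passes the later trees, which lie in the image of $\mathrm{sh}^2$.
      simp only [List.nil_append, List.length_nil, evalForest, map_mul, mul_assoc,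
        evalTree_treeBracket, ← bS_mul_sh]
      simp only [← mul_assoc, bracket_mul_sh]
    | cons s u ih =>
      simp only [List.cons_append, evalForest, List.length_cons, ← ih, ← sh_bS, map_mul, mul_assoc]

/-! ### Localization of a set at an injective self-map -/

/-- Self-maps of `X`, with reversed composition. -/
def RevEnd (X : Type u) : Type u := X → X

namespace RevEnd

instance (X : Type u) : Monoid (RevEnd X) where
  mul F G := fun x => G (F x)
  one := fun x => x
  mul_assoc _ _ _ := rfl
  one_mul _ := rfl
  mul_one _ := rfl

theorem mul_apply {X : Type u} (F G : RevEnd X) (x : X) : (F * G) x = G (F x) := rfl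

/-- A bijection as a unit. -/
noncomputable def unitOfBijective {X : Type u} (F : RevEnd X) (h : Function.Bijective F) :
    (RevEnd X)ˣ where
  val := F
  inv := fun x => (Equiv.ofBijective F h).symm x
  val_inv := funext fun x => (Equiv.ofBijective F h).symm_apply_apply x
  inv_val := funext fun x => (Equiv.ofBijective F h).apply_symm_apply x

end RevEnd

section Localization

variable {X : Type u}

/-- The pair `(x, k)` stands for `τ⁻ᵏ x`. -/
def locSetoid (τ : X → X) (hτ : Function.Injective τ) : Setoid (X × ℕ) where
  r p q := τ^[q.2] p.1 = τ^[p.2] q.1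
  iseqv :=
    { refl := fun _ => rfl
      symm := fun h => h.symm
      trans := by
        rintro ⟨x, k⟩ ⟨y, l⟩ ⟨z, m⟩ h1 h2
        apply hτ.iterate l
        change τ^[l] (τ^[m] x) = τ^[l] (τ^[k] z)
        change τ^[l] x = τ^[k] y at h1
        change τ^[m] y = τ^[l] z at h2
        rw [Function.Commute.iterate_iterate_self τ l m x, h1,
          Function.Commute.iterate_iterate_self τ m k y, h2,
          Function.Commute.iterate_iterate_self τ k l z] }

/-- The localization of `X` at an injective self-map. -/
def Loc (τ : X → X) (hτ : Function.Injective τ) : Type u := Quotient (locSetoid τ hτ)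

variable {τ : X → X} {hτ : Function.Injective τ}

/-- The element `τ⁻ᵏ x` of the localization. -/
def Loc.mk (hτ : Function.Injective τ) (x : X) (k : ℕ) : Loc τ hτ :=
  Quotient.mk (locSetoid τ hτ) (x, k)

theorem Loc.mk_eq_mk {x y : X} {k l : ℕ} : Loc.mk hτ x k = Loc.mk hτ y l ↔ τ^[l] x = τ^[k] y :=
  Quotient.eq (r := locSetoid τ hτ)

theorem Loc.ind {p : Loc τ hτ → Prop} (h : ∀ x k, p (Loc.mk hτ x k)) (z : Loc τ hτ) : p z :=
  Quotient.inductionOn z fun a => h a.1 a.2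

/-- The map induced on the localization. -/
def Loc.map (hτ : Function.Injective τ) (F : X → X) (hF : Function.Commute F τ) :
    RevEnd (Loc τ hτ) :=
  Quotient.map' (s₁ := locSetoid τ hτ) (s₂ := locSetoid τ hτ) (fun p => (F p.1, p.2)) (by
    rintro ⟨x, k⟩ ⟨y, l⟩ h
    change τ^[l] x = τ^[k] y at h
    change τ^[l] (F x) = τ^[k] (F y)
    rw [← (hF.iterate_right l).eq, h, (hF.iterate_right k).eq])

theorem Loc.map_mk (F : X → X) (hF : Function.Commute F τ) (x : X) (k : ℕ) :
    Loc.map hτ F hF (Loc.mk hτ x k) = Loc.mk hτ (F x) k := rfl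

/-- If $F y=\tau x$, then $\tau^{-(k+1)}y$ is a preimage of $\tau^{-k}x$. Thus $F$ need only reach
the image of $\tau$. -/
theorem Loc.map_bijective (F : X → X) (hF : Function.Commute F τ) (inj : Function.Injective F)
    (surj : ∀ x, ∃ y, F y = τ x) : Function.Bijective (Loc.map hτ F hF) := by
  constructor
  · intro a b
    induction a using Loc.ind with | h x k => ?_
    induction b using Loc.ind with | h y l => ?_
    rw [Loc.map_mk, Loc.map_mk, Loc.mk_eq_mk, Loc.mk_eq_mk, ← (hF.iterate_right l).eq,
      ← (hF.iterate_right k).eq]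
    exact fun h => inj h
  · intro a
    induction a using Loc.ind with | h x k => ?_
    obtain ⟨y, hy⟩ := surj x
    refine ⟨Loc.mk hτ y (k + 1), ?_⟩
    rw [Loc.map_mk, Loc.mk_eq_mk, hy]
    exact (Function.iterate_succ_apply τ k x).symm

theorem BFamily.loc {a σ : ℕ → RevEnd X} (h : BFamily a σ)
    (ha : ∀ i, Function.Commute (a i) τ) (hσ : ∀ i, Function.Commute (σ i) τ) :
    BFamily (fun i => Loc.map hτ (a i) (ha i)) (fun i => Loc.map hτ (σ i) (hσ i)) := by
  constructor
  all_goals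
    intros
    funext z
    induction z using Loc.ind with | h x k => ?_
    refine congrArg (fun y => Loc.mk hτ y k) ?_
  · exact congrFun (h.aa _ _) x
  · exact congrFun (h.aσ _ _) x
  · exact congrFun (h.σa _ _) x
  · exact congrFun (h.σσ _ _) x
  · exact congrFun (h.braid _) x
  · exact congrFun (h.mixed₁ _) x
  · exact congrFun (h.mixed₂ _) x

end Localization

/-! ### Codes of trees -/

/-- The number of leaves coded by a natural number. -/
def codeSize : ℕ → ℕ
  -- The codes $0$ (empty) and $1$ (a leaf) are $\langle 0,0\rangle$ and $\langle 0,1\rangle$, where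
  -- unpairing does not descend; from $2$ on both components are smaller.
  | 0 => 0
  | 1 => 1
  | n + 2 => codeSize (n + 2).unpair.1 + codeSize (n + 2).unpair.2
decreasing_by
  · exact Nat.unpair_lt (by omega)
  · have h := Nat.pair_unpair (n + 2)
    have h2 := Nat.unpair_right_le (n + 2)
    refine lt_of_le_of_ne h2 fun e => ?_
    rw [e, Nat.pair] at h
    split_ifs at h with h3
    · nlinarith
    · have := Nat.unpair_lt (n := n + 2) (by omega)
      omega

/-- Additivity also holds for codes of no tree, so any slot, even a leaf or an empty one, can be
split. -/
theorem codeSize_pair (a b : ℕ) : codeSize (Nat.pair a b) = codeSize a + codeSize b := by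
  have key : ∀ n, codeSize n = codeSize n.unpair.1 + codeSize n.unpair.2
    | 0 => by simp [codeSize]
    | 1 => by
      have : Nat.unpair 1 = (0, 1) := Nat.unpair_pair 0 1
      simp [codeSize, this]
    | n + 2 => by rw [codeSize]
  simpa using key (Nat.pair a b)

/-- The code of the shape of a tree. -/
def code {L : Type u} : FreeMagma L → ℕ
  | FreeMagma.of _ => 1
  | FreeMagma.mul t₁ t₂ => Nat.pair (code t₁) (code t₂)

@[simp] theorem code_of {L : Type u} (x : L) : code (FreeMagma.of x) = 1 := rfl

@[simp] theorem code_mul {L : Type u} (t₁ t₂ : FreeMagma L) :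
    code (t₁ * t₂) = Nat.pair (code t₁) (code t₂) := rfl

theorem code_map {L : Type u} {M : Type v} (f : L → M) (t : FreeMagma L) :
    code (FreeMagma.map f t) = code t := by
  induction t using FreeMagma.recOnMul with
  | ih1 x => rfl
  | ih2 x y hx hy => rw [map_mul, code_mul, hx, hy, code_mul]

theorem length_labels {L : Type u} (t : FreeMagma L) : (labels t).length = codeSize (code t) := by
  induction t using FreeMagma.recOnMul with
  | ih1 x => simp [codeSize]
  | ih2 x y hx hy => simp [codeSize_pair, hx, hy]

theorem length_labels_pos {L : Type u} (t : FreeMagma L) : 0 < (labels t).length := by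
  induction t using FreeMagma.recOnMul with
  | ih1 x => simp
  | ih2 x y hx hy => rw [labels_mul, List.length_append]; omega

theorem code_ne_zero {L : Type u} (t : FreeMagma L) : code t ≠ 0 := fun h => by
  have := length_labels_pos t
  rw [length_labels, h] at this
  simp [codeSize] at this

/-- A coloured tree is determined by its shape and its labels. -/
theorem eq_of_code_labels {L : Type u} {s t : FreeMagma L} (hc : code s = code t)
    (hl : labels s = labels t) : s = t := by
  -- The leaf code $1$ is also the pair $\langle 0,1\rangle$, but no tree has code $0$.
  have h01 : ∀ a b : FreeMagma L, Nat.pair (code a) (code b) ≠ 1 := fun a b h => by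
    have h' := congrArg Nat.unpair h
    rw [Nat.unpair_pair] at h'
    exact code_ne_zero a (Prod.ext_iff.1 h').1
  induction s using FreeMagma.recOnMul generalizing t with
  | ih1 x =>
    cases t using FreeMagma.recOnMul with
    | ih1 y => exact congrArg FreeMagma.of (List.singleton_inj.1 hl)
    | ih2 a b => exact absurd hc.symm (h01 a b)
  | ih2 a b ha hb =>
    cases t using FreeMagma.recOnMul with
    | ih1 y => exact absurd hc (h01 a b)
    | ih2 c d =>
      obtain ⟨h1, h2⟩ := Nat.pair_eq_pair.1 hc
      obtain ⟨h3, h4⟩ := List.append_inj hl (by rw [length_labels, length_labels, h1])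
      rw [ha h1 h3, hb h2 h4]

/-! ### Coloured sequences of slots -/

/-- Only finitely many slots are nonempty, and their total size is `n`. -/
inductive Fits : Stream' ℕ → ℕ → Prop
  | nil : Fits (Stream'.const 0) 0
  | cons (c : ℕ) (s : Stream' ℕ) (n : ℕ) (h : Fits s n) : Fits (Stream'.cons c s) (codeSize c + n)

theorem Fits.exists_tail {s : Stream' ℕ} {n : ℕ} (h : Fits s n) :
    ∃ k, n = codeSize s.head + k ∧ Fits s.tail k := by
  cases h with
  | nil => exact ⟨0, by simp [codeSize], Fits.nil⟩
  | cons c s n h => exact ⟨n, rfl, h⟩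

/-- A sequence of shapes together with a list of labels for all their leaves. -/
@[ext] structure Slots (L : Type u) where
  codes : Stream' ℕ
  labs : List L
  fits : Fits codes labs.length

namespace Slots

variable {L : Type u}

/-- The empty sequence. -/
def nil : Slots L := ⟨Stream'.const 0, [], Fits.nil⟩

/-- Adding a slot in front. -/
def cons (c : ℕ) (u : List L) (h : u.length = codeSize c) (x : Slots L) : Slots L :=
  ⟨Stream'.cons c x.codes, u ++ x.labs, by
    rw [List.length_append, h]; exact Fits.cons _ _ _ x.fits⟩

/-- The labels of the first slot. -/
def front (x : Slots L) : List L := x.labs.take (codeSize x.codes.head)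

theorem length_front (x : Slots L) : x.front.length = codeSize x.codes.head := by
  obtain ⟨k, hk, -⟩ := x.fits.exists_tail
  rw [front, List.length_take]
  omega

/-- The sequence without its first slot. -/
def tail (x : Slots L) : Slots L :=
  ⟨x.codes.tail, x.labs.drop (codeSize x.codes.head), by
    obtain ⟨k, hk, h⟩ := x.fits.exists_tail
    rwa [List.length_drop, hk, Nat.add_sub_cancel_left]⟩

@[simp] theorem codes_cons (c : ℕ) (u : List L) (h) (x : Slots L) :
    (cons c u h x).codes = Stream'.cons c x.codes := rfl

@[simp] theorem labs_cons (c : ℕ) (u : List L) (h) (x : Slots L) :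
    (cons c u h x).labs = u ++ x.labs := rfl

@[simp] theorem front_cons (c : ℕ) (u : List L) (h) (x : Slots L) : (cons c u h x).front = u := by
  simp [front, ← h]

@[simp] theorem tail_cons (c : ℕ) (u : List L) (h) (x : Slots L) : (cons c u h x).tail = x := by
  ext1
  · rfl
  · simp [tail, ← h]

theorem exists_cons (x : Slots L) : ∃ c u h y, x = cons c u h y := by
  refine ⟨x.codes.head, x.front, x.length_front, x.tail, ?_⟩
  ext1
  · exact (Stream'.eta _).symm
  · exact (List.take_append_drop _ _).symm

theorem cons_inj {c c' : ℕ} {u u' : List L} {h h'} {x x' : Slots L}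
    (e : cons c u h x = cons c' u' h' x') : c = c' ∧ u = u' ∧ x = x' := by
  refine ⟨congrArg (fun y => y.codes.head) e, ?_, ?_⟩
  · simpa using congrArg front e
  · simpa using congrArg tail e

/-- Acting on the sequence from the second slot on. -/
def shiftFun (F : RevEnd (Slots L)) : RevEnd (Slots L) := fun x =>
  cons x.codes.head x.front x.length_front (F x.tail)

theorem shiftFun_cons (F : RevEnd (Slots L)) (c : ℕ) (u : List L) (h) (x : Slots L) :
    shiftFun F (cons c u h x) = cons c u h (F x) := by
  simp only [shiftFun, tail_cons, front_cons, codes_cons, Stream'.head_cons]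

/-- Acting on the sequence from the second slot on, as a homomorphism. -/
def shift : RevEnd (Slots L) →* RevEnd (Slots L) where
  toFun := shiftFun
  map_one' := funext fun x => by
    obtain ⟨c, u, h, y, rfl⟩ := x.exists_cons
    exact shiftFun_cons _ _ _ _ _
  map_mul' F G := funext fun x => by
    obtain ⟨c, u, h, y, rfl⟩ := x.exists_cons
    simp only [RevEnd.mul_apply, shiftFun_cons]

theorem shift_cons (F : RevEnd (Slots L)) (c : ℕ) (u : List L) (h) (x : Slots L) :
    shift F (cons c u h x) = cons c u h (F x) := shiftFun_cons _ _ _ _ _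

theorem shift_injective {F : RevEnd (Slots L)} (hF : Function.Injective F) :
    Function.Injective (shift F) := by
  intro x y h
  obtain ⟨c, u, hu, x, rfl⟩ := x.exists_cons
  obtain ⟨c', u', hu', y, rfl⟩ := y.exists_cons
  rw [shift_cons, shift_cons] at h
  obtain ⟨rfl, rfl, h'⟩ := cons_inj h
  rw [hF h']

theorem iterate_shift_injective {F : RevEnd (Slots L)} (hF : Function.Injective F) (i : ℕ) :
    Function.Injective (shift^[i] F) := by
  induction i with
  | zero => exact hF
  | succ i ih => rw [Function.iterate_succ_apply']; exact shift_injective ih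

theorem ext_cons₂ {F G : RevEnd (Slots L)}
    (H : ∀ c u h d v k x, F (cons c u h (cons d v k x)) = G (cons c u h (cons d v k x))) :
    F = G := funext fun x => by
  obtain ⟨c, u, h, x, rfl⟩ := x.exists_cons
  obtain ⟨d, v, k, x, rfl⟩ := x.exists_cons
  exact H _ _ _ _ _ _ _

theorem ext_cons₃ {F G : RevEnd (Slots L)}
    (H : ∀ c u h d v k e w l x, F (cons c u h (cons d v k (cons e w l x))) =
      G (cons c u h (cons d v k (cons e w l x)))) :
    F = G := ext_cons₂ fun c u h d v k x => by
  obtain ⟨e, w, l, x, rfl⟩ := x.exists_cons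
  exact H _ _ _ _ _ _ _ _ _ _

/-- Merging the first two slots. -/
def merge : RevEnd (Slots L) := fun x =>
  cons (Nat.pair x.codes.head x.tail.codes.head) (x.front ++ x.tail.front)
    (by rw [List.length_append, length_front, length_front, codeSize_pair]) x.tail.tail

theorem merge_cons (c : ℕ) (u : List L) (h) (d : ℕ) (v : List L) (k) (x : Slots L) :
    merge (cons c u h (cons d v k x)) =
      cons (Nat.pair c d) (u ++ v) (by rw [List.length_append, h, k, codeSize_pair]) x := by
  simp only [merge, tail_cons, front_cons, codes_cons, Stream'.head_cons]

/-- Splitting the first slot. -/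
def split : RevEnd (Slots L) := fun x =>
  ⟨Stream'.cons x.codes.head.unpair.1 (Stream'.cons x.codes.head.unpair.2 x.codes.tail), x.labs, by
    obtain ⟨k, hk, h⟩ := x.fits.exists_tail
    rw [hk, ← Nat.pair_unpair x.codes.head, codeSize_pair, Nat.pair_unpair, add_assoc]
    exact Fits.cons _ _ _ (Fits.cons _ _ _ h)⟩

theorem merge_split (x : Slots L) : merge (split x) = x := by
  have hl : ∀ y : Slots L, (merge y).labs = y.labs := fun y => by
    obtain ⟨c, u, h, y, rfl⟩ := y.exists_cons
    obtain ⟨d, v, k, y, rfl⟩ := y.exists_cons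
    rw [merge_cons]
    simp
  ext1
  · change Stream'.cons (Nat.pair x.codes.head.unpair.1 x.codes.head.unpair.2) x.codes.tail = _
    rw [Nat.pair_unpair, Stream'.eta]
  · exact hl _

section Shelf

variable [Shelf L]

/-- Crossing the first two slots. -/
def cross : RevEnd (Slots L) := fun x =>
  cons x.tail.codes.head (x.tail.front.map (lact x.front))
    (by rw [List.length_map, length_front])
    (cons x.codes.head x.front x.length_front x.tail.tail)

theorem cross_cons (c : ℕ) (u : List L) (h) (d : ℕ) (v : List L) (k) (x : Slots L) :
    cross (cons c u h (cons d v k x)) =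
      cons d (v.map (lact u)) (by rw [List.length_map, k]) (cons c u h x) := by
  simp only [cross, tail_cons, front_cons, codes_cons, Stream'.head_cons]

/-- The braid relation is the block LD law; the mixed relations say that a concatenation acts by
composition and is acted on blockwise. -/
theorem bFamily : BFamily (fun i => shift^[i] (merge : RevEnd (Slots L)))
    (fun i => shift^[i] (cross : RevEnd (Slots L))) := by
  apply BFamily.of_shift
  · intro F
    refine ext_cons₂ fun c u h d v k x => ?_
    simp only [RevEnd.mul_apply, merge_cons, shift_cons]
  · intro F
    refine ext_cons₂ fun c u h d v k x => ?_
    simp only [RevEnd.mul_apply, cross_cons, shift_cons]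
  · refine ext_cons₃ fun c u h d v k e w l x => ?_
    simp only [RevEnd.mul_apply, cross_cons, shift_cons, map_lact_map]
  · refine ext_cons₃ fun c u h d v k e w l x => ?_
    simp only [RevEnd.mul_apply, cross_cons, merge_cons, shift_cons, map_lact_append]
  · refine ext_cons₃ fun c u h d v k e w l x => ?_
    simp only [RevEnd.mul_apply, cross_cons, merge_cons, shift_cons, List.map_append]

/-- The full twist on the labels. -/
def twist (x : Slots L) : Slots L := ⟨x.codes, fullTwist x.labs, by simpa using x.fits⟩

end Shelf

end Slots

/-! ### Crossings and the full twist -/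

/-- The total size of the first `i` slots. -/
def offset : ℕ → Stream' ℕ → ℕ
  | 0, _ => 0
  | i + 1, s => codeSize s.head + offset i s.tail

/-- Exchanging the `i`-th and `i + 1`-st terms. -/
def swapAt : ℕ → Stream' ℕ → Stream' ℕ
  | 0, s => Stream'.cons s.tail.head (Stream'.cons s.head s.tail.tail)
  | i + 1, s => Stream'.cons s.head (swapAt i s.tail)

theorem swapAt_swapAt (i : ℕ) (s : Stream' ℕ) : swapAt i (swapAt i s) = s := by
  induction i generalizing s with
  | zero =>
    change Stream'.cons s.head (Stream'.cons s.tail.head s.tail.tail) = s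
    rw [Stream'.eta, Stream'.eta]
  | succ i ih =>
    change Stream'.cons s.head (swapAt i (swapAt i s.tail)) = s
    rw [ih, Stream'.eta]

theorem offset_swapAt (i : ℕ) (s : Stream' ℕ) : offset i (swapAt i s) = offset i s := by
  induction i generalizing s with
  | zero => rfl
  | succ i ih => exact congrArg (codeSize s.head + ·) (ih s.tail)

theorem get_swapAt (i : ℕ) (s : Stream' ℕ) : (swapAt i s).get i = s.get (i + 1) := by
  induction i generalizing s with
  | zero => rfl
  | succ i ih => exact ih s.tail

theorem get_swapAt_succ (i : ℕ) (s : Stream' ℕ) : (swapAt i s).get (i + 1) = s.get i := by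
  induction i generalizing s with
  | zero => rfl
  | succ i ih => exact ih s.tail

theorem Fits.le {s : Stream' ℕ} {n : ℕ} (h : Fits s n) (i : ℕ) :
    offset i s + codeSize (s.get i) + codeSize (s.get (i + 1)) ≤ n := by
  induction i generalizing s n with
  | zero =>
    obtain ⟨k, rfl, h1⟩ := h.exists_tail
    obtain ⟨l, rfl, -⟩ := h1.exists_tail
    change 0 + codeSize s.head + codeSize s.tail.head ≤ _
    omega
  | succ i ih =>
    obtain ⟨k, rfl, h1⟩ := h.exists_tail
    have := ih h1
    change codeSize s.head + offset i s.tail + codeSize (s.tail.get i) +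
      codeSize (s.tail.get (i + 1)) ≤ _
    omega

namespace Slots

variable {L : Type u}

theorem exists_slot_blocks (x : Slots L) (i : ℕ) :
    ∃ u v w z : List L, x.labs = u ++ v ++ w ++ z ∧ u.length = offset i x.codes ∧
      v.length = codeSize (x.codes.get i) ∧ w.length = codeSize (x.codes.get (i + 1)) := by
  have := x.fits.le i
  obtain ⟨u, v, w, z, h, h1, h2, h3, -⟩ := exists_blocks x.labs (offset i x.codes)
    (codeSize (x.codes.get i)) (codeSize (x.codes.get (i + 1)))
    (x.labs.length - (offset i x.codes + codeSize (x.codes.get i) +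
      codeSize (x.codes.get (i + 1)))) (by omega)
  exact ⟨u, v, w, z, h, h1, h2, h3⟩

theorem codes_iterate_shift_eq {F G : RevEnd (Slots L)}
    (h : ∀ x y : Slots L, x.codes = y.codes → (F x).codes = (G y).codes) (i : ℕ) (x y : Slots L)
    (e : x.codes = y.codes) : (shift^[i] F x).codes = (shift^[i] G y).codes := by
  induction i generalizing x y with
  | zero => exact h x y e
  | succ i ih =>
    obtain ⟨c, u, hu, x, rfl⟩ := x.exists_cons
    obtain ⟨d, v, hv, y, rfl⟩ := y.exists_cons
    rw [Function.iterate_succ_apply', Function.iterate_succ_apply', shift_cons, shift_cons]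
    simp only [codes_cons] at e ⊢
    obtain ⟨rfl, e'⟩ := Stream'.cons_injective2 e
    rw [ih x y e']

theorem labs_iterate_merge (i : ℕ) (x : Slots L) : (shift^[i] merge x).labs = x.labs := by
  induction i generalizing x with
  | zero =>
    obtain ⟨c, u, hu, x, rfl⟩ := x.exists_cons
    obtain ⟨d, v, hv, x, rfl⟩ := x.exists_cons
    change (merge _).labs = _
    rw [merge_cons]
    simp
  | succ i ih =>
    obtain ⟨c, u, hu, x, rfl⟩ := x.exists_cons
    rw [Function.iterate_succ_apply', shift_cons, labs_cons, ih, labs_cons]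

theorem iterate_merge_split (i : ℕ) (x : Slots L) :
    shift^[i] merge (shift^[i] split x) = x := by
  have h : (split * merge : RevEnd (Slots L)) = 1 := funext merge_split
  have h' := congrArg (shift^[i]) h
  rw [iterate_map_mul, iterate_map_one] at h'
  exact congrFun h' x

theorem merge_injective : Function.Injective (merge : RevEnd (Slots L)) := by
  intro x y h
  obtain ⟨c, u, hu, x, rfl⟩ := x.exists_cons
  obtain ⟨d, v, hv, x, rfl⟩ := x.exists_cons
  obtain ⟨c', u', hu', y, rfl⟩ := y.exists_cons
  obtain ⟨d', v', hv', y, rfl⟩ := y.exists_cons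
  rw [merge_cons, merge_cons] at h
  obtain ⟨h1, h2, rfl⟩ := cons_inj h
  obtain ⟨rfl, rfl⟩ := Nat.pair_eq_pair.1 h1
  obtain ⟨rfl, rfl⟩ := List.append_inj h2 (by rw [hu, hu'])
  rfl

section Shelf

variable [Shelf L]

theorem cross_injective (hL : ∀ x : L, Function.Injective (fun y : L => x ◃ y)) :
    Function.Injective (cross : RevEnd (Slots L)) := by
  have hl : ∀ u : List L, Function.Injective (lact u) := fun u => by
    induction u with
    | nil => exact fun _ _ h => h
    | cons x u ih => exact fun _ _ h => ih (hL x h)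
  intro x y h
  obtain ⟨c, u, hu, x, rfl⟩ := x.exists_cons
  obtain ⟨d, v, hv, x, rfl⟩ := x.exists_cons
  obtain ⟨c', u', hu', y, rfl⟩ := y.exists_cons
  obtain ⟨d', v', hv', y, rfl⟩ := y.exists_cons
  rw [cross_cons, cross_cons] at h
  obtain ⟨rfl, h2, h⟩ := cons_inj h
  obtain ⟨rfl, rfl, rfl⟩ := cons_inj h
  obtain rfl := List.map_injective_iff.2 (hl _) h2
  rfl

theorem codes_iterate_cross (i : ℕ) (x : Slots L) :
    (shift^[i] cross x).codes = swapAt i x.codes := by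
  induction i generalizing x with
  | zero => rfl
  | succ i ih =>
    obtain ⟨c, u, hu, x, rfl⟩ := x.exists_cons
    rw [Function.iterate_succ_apply', shift_cons, codes_cons, ih]
    rfl

/-- This identifies crossing slots with crossing blocks of the label list, where the results on the
full twist apply. -/
theorem labs_iterate_cross (i : ℕ) (x : Slots L) (u v w z : List L)
    (h : x.labs = u ++ v ++ w ++ z) (hu : u.length = offset i x.codes)
    (hv : v.length = codeSize (x.codes.get i)) (hw : w.length = codeSize (x.codes.get (i + 1))) :
    (shift^[i] cross x).labs = u ++ w.map (lact v) ++ v ++ z := by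
  induction i generalizing x u with
  | zero =>
    obtain ⟨c, v', hc, x, rfl⟩ := x.exists_cons
    obtain ⟨d, w', hd, x, rfl⟩ := x.exists_cons
    obtain rfl := List.length_eq_zero_iff.1 hu
    change v.length = codeSize c at hv
    change w.length = codeSize d at hw
    simp only [labs_cons, List.nil_append, List.append_assoc] at h
    obtain ⟨rfl, h'⟩ := List.append_inj h (by omega)
    obtain ⟨rfl, rfl⟩ := List.append_inj h' (by omega)
    change (cross _).labs = _
    rw [cross_cons]
    simp
  | succ i ih =>
    obtain ⟨c, u', hc, x, rfl⟩ := x.exists_cons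
    change u.length = codeSize c + offset i x.codes at hu
    obtain ⟨u₁, rfl⟩ : ∃ u₁, u = u' ++ u₁ := by
      simp only [labs_cons, List.append_assoc] at h
      obtain ⟨a, h1, -⟩ | ⟨a, h1, h2⟩ := List.append_eq_append_iff.1 h
      · exact ⟨a, h1⟩
      · have := congrArg List.length h1
        rw [List.length_append] at this
        obtain rfl := List.length_eq_zero_iff.1 (show a.length = 0 by omega)
        exact ⟨[], by simpa using h1.symm⟩
    rw [Function.iterate_succ_apply', shift_cons, labs_cons, ih x u₁]
    · simp only [List.append_assoc]
    · simpa [List.append_assoc] using h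
    · rw [List.length_append] at hu
      omega
    · exact hv
    · exact hw

theorem twist_injective (hL : ∀ x : L, Function.Injective (fun y : L => x ◃ y)) :
    Function.Injective (twist : Slots L → Slots L) := fun _ _ h =>
  Slots.ext (congrArg (fun z : Slots L => z.codes) h :)
    (fullTwist_injective hL (congrArg (fun z : Slots L => z.labs) h :))

/-- Merging changes only the codes, twisting only the labels. -/
theorem iterate_merge_twist (i : ℕ) :
    Function.Commute (shift^[i] merge : RevEnd (Slots L)) twist := fun x => by
  ext1
  · exact codes_iterate_shift_eq (fun x y e => by simp [merge, e, tail]) i _ _ rfl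
  · rw [labs_iterate_merge]
    exact (congrArg fullTwist (labs_iterate_merge i x)).symm

theorem iterate_cross_twist (i : ℕ) :
    Function.Commute (shift^[i] cross : RevEnd (Slots L)) twist := fun x => by
  ext1
  · rw [codes_iterate_cross]
    exact (codes_iterate_cross i x).symm
  · obtain ⟨u, v, w, z, h, hu, hv, hw⟩ := x.exists_slot_blocks i
    obtain ⟨u', v', w', z', h1, h2, h3, h4, h5, h6⟩ := fullTwist_cross u v w z
    rw [labs_iterate_cross i x.twist u' v' w' z' (by rw [← h5, ← h]; rfl) (h1.trans hu)
      (h2.trans hv) (h3.trans hw), ← h6]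
    exact (congrArg fullTwist (labs_iterate_cross i x u v w z h hu hv hw)).symm

theorem exists_iterate_cross_eq_twist (i : ℕ) (x : Slots L) :
    ∃ y, (shift^[i] cross : RevEnd (Slots L)) y = twist x := by
  obtain ⟨u, v, w, z, h, hu, hv, hw⟩ := x.exists_slot_blocks i
  obtain ⟨u', v', w', z', h1, h2, h3, h4, h5⟩ := fullTwist_eq_cross u v w z
  have hf : Fits (swapAt i x.codes) (u' ++ v' ++ w' ++ z').length := by
    have := (shift^[i] cross x).fits
    rw [codes_iterate_cross, labs_iterate_cross i x u v w z h hu hv hw] at this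
    convert this using 1
    simp only [List.length_append, List.length_map]
    omega
  -- The codes are exchanged beforehand, since the crossing exchanges them back.
  refine ⟨⟨swapAt i x.codes, u' ++ v' ++ w' ++ z', hf⟩, ?_⟩
  ext1
  · rw [codes_iterate_cross]
    exact swapAt_swapAt i x.codes
  · rw [labs_iterate_cross i _ u' v' w' z' rfl, ← h5, ← h]
    · rfl
    · rw [offset_swapAt, h1, hu]
    · rw [get_swapAt, h2, hw]
    · rw [get_swapAt_succ, h3, hv]

end Shelf

/-- The sequence of slots given by a sequence of trees. -/
def ofForest : List (FreeMagma L) → Slots L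
  | [] => nil
  | t :: f => cons (code t) (labels t) (length_labels t) (ofForest f)

theorem iterate_shift_ofForest (F : RevEnd (Slots L)) (f g g' : List (FreeMagma L))
    (h : F (ofForest g) = ofForest g') :
    shift^[f.length] F (ofForest (f ++ g)) = ofForest (f ++ g') := by
  induction f with
  | nil => exact h
  | cons t f ih =>
    rw [List.length_cons, Function.iterate_succ_apply']
    change shift _ (cons _ _ _ (ofForest (f ++ g))) = _
    rw [shift_cons, ih]
    rfl

theorem merge_ofForest (t₁ t₂ : FreeMagma L) (f : List (FreeMagma L)) :
    merge (ofForest (t₁ :: t₂ :: f)) = ofForest ((t₁ * t₂) :: f) := merge_cons _ _ _ _ _ _ _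

theorem cross_ofForest [Shelf L] (t₁ t₂ : FreeMagma L) (f : List (FreeMagma L)) :
    cross (ofForest (t₁ :: t₂ :: f)) = ofForest (treeBracket t₁ t₂ :: t₁ :: f) := by
  refine (cross_cons _ _ _ _ _ _ _).trans ?_
  simp only [ofForest, labels_treeBracket]
  congr 1
  exact (code_map _ _).symm

end Slots

/-! ### The model of `B_•` on coloured sequences of slots -/

section SlotModel

variable (L : LCSystem.{u})

/-- The localization of the set of coloured sequences of slots at the full twist. -/
abbrev LocSlots : Type u :=
  Loc (Slots.twist : Slots L.carrier → Slots L.carrier) (Slots.twist_injective L.left_cancel)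

/-- The action of `a i`. -/
noncomputable def slotA (i : ℕ) : (RevEnd (LocSlots L))ˣ :=
  RevEnd.unitOfBijective (Loc.map _ (Slots.shift^[i] Slots.merge) (Slots.iterate_merge_twist i))
    (Loc.map_bijective _ _ (Slots.iterate_shift_injective Slots.merge_injective i)
      fun x => ⟨_, Slots.iterate_merge_split i x.twist⟩)

/-- The action of `σ i`. -/
noncomputable def slotS (i : ℕ) : (RevEnd (LocSlots L))ˣ :=
  RevEnd.unitOfBijective (Loc.map _ (Slots.shift^[i] Slots.cross) (Slots.iterate_cross_twist i))
    (Loc.map_bijective _ _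
      (Slots.iterate_shift_injective (Slots.cross_injective L.left_cancel) i)
      fun x => Slots.exists_iterate_cross_eq_twist i x)

theorem slotFamily : BFamily (slotA L) (slotS L) :=
  BFamily.units (Slots.bFamily.loc Slots.iterate_merge_twist Slots.iterate_cross_twist)

/-- The model of `B_•` on coloured sequences of slots. -/
noncomputable def slotModel : Model L.carrier (LocSlots L) where
  act x := ((slotFamily L).lift x).val
  act_one z := by rw [map_one]; rfl
  act_mul x y z := by rw [map_mul]; rfl
  val f := Loc.mk _ (Slots.ofForest f) 0
  val_a u t₁ t₂ v := by
    rw [BFamily.lift_bA]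
    exact congrArg (fun y => Loc.mk _ y 0)
      (Slots.iterate_shift_ofForest _ _ _ _ (Slots.merge_ofForest t₁ t₂ v))
  val_σ u t₁ t₂ v := by
    rw [BFamily.lift_bS]
    exact congrArg (fun y => Loc.mk _ y 0)
      (Slots.iterate_shift_ofForest _ _ _ _ (Slots.cross_ofForest t₁ t₂ v))

/-- The sequence of trees hanging from the right spine of a tree. -/
def spine {L : Type u} : FreeMagma L → List (FreeMagma L)
  | FreeMagma.of x => [FreeMagma.of x]
  | FreeMagma.mul t₁ t₂ => t₁ :: spine t₂

@[simp] theorem spine_mul {L : Type u} (t₁ t₂ : FreeMagma L) :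
    spine (t₁ * t₂) = t₁ :: spine t₂ := rfl

/-- Only empty slots follow the spine, and no tree has the empty code, so the end of the spine is
visible. -/
theorem ofForest_spine_injective {L : Type u} :
    Function.Injective (fun t : FreeMagma L => Slots.ofForest (spine t)) := by
  have h0 : ∀ t : FreeMagma L, Slots.ofForest (spine t) ≠ Slots.nil := fun t h => by
    have h1 := congrArg (fun x : Slots L => x.codes.head) h
    cases t using FreeMagma.recOnMul with
    | ih1 x => exact code_ne_zero (FreeMagma.of x) h1
    | ih2 t₁ t₂ => exact code_ne_zero t₁ h1
  intro s t h
  induction s using FreeMagma.recOnMul generalizing t with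
  | ih1 x =>
    cases t using FreeMagma.recOnMul with
    | ih1 y => exact congrArg FreeMagma.of (List.singleton_inj.1 (Slots.cons_inj h).2.1)
    | ih2 a b => exact absurd (Slots.cons_inj h).2.2.symm (h0 b)
  | ih2 a b _ hb =>
    cases t using FreeMagma.recOnMul with
    | ih1 y => exact absurd (Slots.cons_inj h).2.2 (h0 b)
    | ih2 c d =>
      obtain ⟨h1, h2, h3⟩ := Slots.cons_inj h
      rw [eq_of_code_labels h1 h2, hb h3]

theorem slotModel_val_injective :
    Function.Injective (fun t : FreeMagma L.carrier => (slotModel L).val (spine t)) :=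
  fun _ _ h => ofForest_spine_injective (Loc.mk_eq_mk.1 h)

end SlotModel

/-! ### The elements of `B_•` attached to addresses -/

/-- The action at an address inside the first tree of a sequence, if `e` is the action at its
root. -/
def innerElt (e : BBullet) : List Bool → BBullet
  | [] => e
  -- The tree is split, one half is acted on, and the halves are merged again.
  | false :: α => (bA 0)⁻¹ * innerElt e α * bA 0
  | true :: α => (bA 0)⁻¹ * sh (innerElt e α) * bA 0

/-- The action at an address, if `b` is the action at the root and `e` is the action at the root
of the left subtree. -/
def outerElt (b e : BBullet) : List Bool → BBullet
  | [] => b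
  | false :: α => innerElt e α
  | true :: α => sh (outerElt b e α)

namespace Model

variable {L : Type u} [Shelf L] {Z : Type v} (J : Model L Z)

theorem act_conj {u v : List (FreeMagma L)} {s s' t t' : FreeMagma L} {x : BBullet}
    (h : J.act (sh^[u.length] x) (J.val (u ++ s :: t :: v)) = J.val (u ++ s' :: t' :: v)) :
    J.act (sh^[u.length] ((bA 0)⁻¹ * x * bA 0)) (J.val (u ++ (s * t) :: v)) =
      J.val (u ++ (s' * t') :: v) := by
  rw [iterate_map_mul, iterate_map_mul, iterate_map_inv, sh_iterate_bA, zero_add, J.act_mul,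
    J.act_mul, J.act_inv (J.val_a u s t v), h, J.val_a]

theorem act_innerElt {R : FreeMagma L → FreeMagma L → Prop} {e : BBullet}
    (he : ∀ u v t t', R t t' → J.act (sh^[u.length] e) (J.val (u ++ t :: v)) = J.val (u ++ t' :: v))
    (α : List Bool) (u v : List (FreeMagma L)) (t t' : FreeMagma L) (h : Shift R α t t') :
    J.act (sh^[u.length] (innerElt e α)) (J.val (u ++ t :: v)) = J.val (u ++ t' :: v) := by
  induction α generalizing u v t t' with
  | nil => exact he u v t t' h
  | cons b α ih =>
    cases b
    · obtain ⟨t₁, t₁', t₂, rfl, rfl, h⟩ := h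
      exact J.act_conj (ih u _ _ _ h)
    · obtain ⟨t₁, t₂, t₂', rfl, rfl, h⟩ := h
      refine J.act_conj ?_
      simpa using ih (u ++ [t₁]) v _ _ h

theorem act_outerElt {R : FreeMagma L → FreeMagma L → Prop} {b e : BBullet}
    (hb : ∀ u t t', R t t' →
      J.act (sh^[u.length] b) (J.val (u ++ spine t)) = J.val (u ++ spine t'))
    (he : ∀ u v t t', R t t' → J.act (sh^[u.length] e) (J.val (u ++ t :: v)) = J.val (u ++ t' :: v))
    (α : List Bool) (u : List (FreeMagma L)) (t t' : FreeMagma L) (h : Shift R α t t') :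
    J.act (sh^[u.length] (outerElt b e α)) (J.val (u ++ spine t)) = J.val (u ++ spine t') := by
  induction α generalizing u t t' with
  | nil => exact hb u t t' h
  | cons c α ih =>
    cases c
    · obtain ⟨t₁, t₁', t₂, rfl, rfl, h⟩ := h
      exact J.act_innerElt he α u _ _ _ h
    · obtain ⟨t₁, t₂, t₂', rfl, rfl, h⟩ := h
      simpa [outerElt] using ih (u ++ [t₁]) _ _ h

end Model

/-- The element of `B_•` attached to the operator `A_α`. -/
def eltA (α : List Bool) : BBullet :=
  -- Inside a slot, $t_1(t_2t_3)$ must first be split into $t_1,t_2,t_3$; on the spine these cuts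
  -- are already made.
  outerElt (bA 0) ((bA 0)⁻¹ * ((bA 1)⁻¹ * bA 0) * bA 0) α

/-- The element of `B_•` attached to the operator `S_α`. -/
def eltS (α : List Bool) : BBullet :=
  outerElt (bS 0) ((bA 0)⁻¹ * ((bA 1)⁻¹ * bS 0 * bA 1) * bA 0) α

namespace Model

variable {L : Type u} [Shelf L] {Z : Type v} (J : Model L Z)

theorem act_bA_succ_inv (u v : List (FreeMagma L)) (t₁ t₂ t₃ : FreeMagma L) :
    J.act (bA (1 + u.length))⁻¹ (J.val (u ++ t₁ :: (t₂ * t₃) :: v)) =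
      J.val (u ++ t₁ :: t₂ :: t₃ :: v) := by
  apply J.act_inv
  simpa [add_comm] using J.val_a (u ++ [t₁]) t₂ t₃ v

theorem act_eltA (α : List Bool) (t t' : FreeMagma L) (h : Shift AssocRel α t t') :
    J.act (eltA α) (J.val (spine t)) = J.val (spine t') := by
  refine J.act_outerElt ?_ ?_ α [] t t' h
  · rintro u _ _ ⟨t₁, t₂, t₃, rfl, rfl⟩
    rw [sh_iterate_bA, zero_add]
    exact J.val_a _ _ _ _
  · rintro u v _ _ ⟨t₁, t₂, t₃, rfl, rfl⟩
    refine J.act_conj ?_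
    rw [iterate_map_mul, iterate_map_inv, sh_iterate_bA, sh_iterate_bA, zero_add, J.act_mul,
      J.act_bA_succ_inv, J.val_a]

theorem act_eltS (α : List Bool) (t t' : FreeMagma L) (h : Shift SemiRel α t t') :
    J.act (eltS α) (J.val (spine t)) = J.val (spine t') := by
  refine J.act_outerElt ?_ ?_ α [] t t' h
  · rintro u _ _ ⟨t₁, t₂, t₃, rfl, rfl⟩
    rw [sh_iterate_bS, zero_add]
    exact J.val_σ _ _ _ _
  · rintro u v _ _ ⟨t₁, t₂, t₃, rfl, rfl⟩
    refine J.act_conj ?_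
    rw [iterate_map_mul, iterate_map_mul, iterate_map_inv, sh_iterate_bA, sh_iterate_bS, zero_add,
      J.act_mul, J.act_mul, J.act_bA_succ_inv, J.val_σ]
    simpa [add_comm] using J.val_a (u ++ [treeBracket t₁ t₂]) t₁ t₃ v

end Model

/-! ### Domains of the operators -/

/-- The minimal length of a branch. -/
def minDepth {L : Type u} : FreeMagma L → ℕ
  | FreeMagma.of _ => 0
  | FreeMagma.mul t₁ t₂ => min (minDepth t₁) (minDepth t₂) + 1

@[simp] theorem minDepth_of {L : Type u} (x : L) : minDepth (FreeMagma.of x) = 0 := rfl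

@[simp] theorem minDepth_mul {L : Type u} (t₁ t₂ : FreeMagma L) :
    minDepth (t₁ * t₂) = min (minDepth t₁) (minDepth t₂) + 1 := rfl

@[simp] theorem minDepth_map {L : Type u} {M : Type v} (f : L → M) (t : FreeMagma L) :
    minDepth (FreeMagma.map f t) = minDepth t := by
  induction t using FreeMagma.recOnMul with
  | ih1 x => rfl
  | ih2 x y hx hy => rw [map_mul, minDepth_mul, hx, hy, minDepth_mul]

theorem exists_mul_of_minDepth {L : Type u} {t : FreeMagma L} {n : ℕ} (h : n + 1 ≤ minDepth t) :
    ∃ t₁ t₂, t = t₁ * t₂ ∧ n ≤ minDepth t₁ ∧ n ≤ minDepth t₂ := by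
  cases t using FreeMagma.recOnMul with
  | ih1 x => simp at h
  | ih2 t₁ t₂ =>
    rw [minDepth_mul] at h
    exact ⟨t₁, t₂, rfl, by omega, by omega⟩

theorem exists_minDepth_eq {L : Type u} [Nonempty L] (n : ℕ) :
    ∃ t : FreeMagma L, minDepth t = n := by
  induction n with
  | zero => exact ⟨FreeMagma.of (Classical.arbitrary L), rfl⟩
  | succ n ih =>
    obtain ⟨t, ht⟩ := ih
    exact ⟨t * t, by simp [ht]⟩

theorem exists_relabel {L : Type u} (t : FreeMagma L) (l : List L)
    (h : l.length = (labels t).length) : ∃ s, labels s = l ∧ minDepth s = minDepth t := by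
  induction t using FreeMagma.recOnMul generalizing l with
  | ih1 x =>
    obtain ⟨y, rfl⟩ := List.length_eq_one_iff.1 h
    exact ⟨FreeMagma.of y, rfl, rfl⟩
  | ih2 a b ha hb =>
    rw [labels_mul, List.length_append] at h
    obtain ⟨s, hs, es⟩ := ha (l.take (labels a).length) (by rw [List.length_take]; omega)
    obtain ⟨t, ht, et⟩ := hb (l.drop (labels a).length) (by rw [List.length_drop]; omega)
    exact ⟨s * t, by rw [labels_mul, hs, ht, List.take_append_drop], by simp [es, et]⟩

theorem exists_map_eq {L : Type u} {M : Type v} (f : L → M) (t : FreeMagma M) (l : List L)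
    (h : labels t = l.map f) : ∃ s, FreeMagma.map f s = t ∧ labels s = l := by
  induction t using FreeMagma.recOnMul generalizing l with
  | ih1 x =>
    obtain ⟨y, rfl⟩ := List.length_eq_one_iff.1 (by
      simpa using (congrArg List.length h).symm : l.length = 1)
    exact ⟨FreeMagma.of y, congrArg FreeMagma.of (List.singleton_inj.1 h).symm, rfl⟩
  | ih2 a b ha hb =>
    obtain ⟨l₁, l₂, rfl, h1, h2⟩ := List.map_eq_append_iff.1 h.symm
    obtain ⟨s, hs, es⟩ := ha l₁ h1.symm
    obtain ⟨t, ht, et⟩ := hb l₂ h2.symm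
    exact ⟨s * t, by rw [map_mul, hs, ht], by rw [labels_mul, es, et]⟩

theorem IsTwist.mono {L : Type u} [Shelf L] {k n : ℕ} (hk : k ≤ n) {l : List L}
    (h : IsTwist n l) : IsTwist k l := by
  induction n, hk using Nat.le_induction with
  | base => exact h
  | succ n _ ih => exact ih h.of_succ

/-- The relation is defined at all sufficiently deep trees with sufficiently twisted labels. -/
def EverDefined {L : Type u} [Shelf L] (n : ℕ) (R : FreeMagma L → FreeMagma L → Prop) : Prop :=
  ∀ t, n ≤ minDepth t → ∀ k u z, IsTwist (k + 1) (u ++ labels t ++ z) →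
    ∃ t', R t t' ∧ minDepth t ≤ minDepth t' + 1 ∧ IsTwist k (u ++ labels t' ++ z)

theorem shift_flip {L : Type u} (R : FreeMagma L → FreeMagma L → Prop) (α : List Bool) (t t' : FreeMagma L) :
    Shift (flip R) α t t' ↔ Shift R α t' t := by
  induction α generalizing t t' with
  | nil => rfl
  | cons b α ih =>
    cases b
    · constructor
      · rintro ⟨a, a', b, rfl, rfl, h⟩
        exact ⟨_, _, _, rfl, rfl, (ih _ _).1 h⟩
      · rintro ⟨a, a', b, rfl, rfl, h⟩
        exact ⟨_, _, _, rfl, rfl, (ih _ _).2 h⟩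
    · constructor
      · rintro ⟨a, b, b', rfl, rfl, h⟩
        exact ⟨_, _, _, rfl, rfl, (ih _ _).1 h⟩
      · rintro ⟨a, b, b', rfl, rfl, h⟩
        exact ⟨_, _, _, rfl, rfl, (ih _ _).2 h⟩

section EverDefined

variable {L : Type u} [Shelf L]

theorem EverDefined.shift {R : FreeMagma L → FreeMagma L → Prop} {n : ℕ} (h : EverDefined n R)
    (α : List Bool) : EverDefined (n + α.length) (Shift R α) := by
  induction α with
  | nil => exact h
  | cons b α ih =>
    intro t ht k u z hk
    obtain ⟨t₁, t₂, rfl, h1, h2⟩ := exists_mul_of_minDepth ht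
    rw [labels_mul] at hk
    cases b
    · obtain ⟨t', h3, h4, h5⟩ := ih t₁ h1 k u (labels t₂ ++ z) (by simpa using hk)
      exact ⟨t' * t₂, ⟨_, _, _, rfl, rfl, h3⟩, by simp only [minDepth_mul]; omega,
        by simpa using h5⟩
    · obtain ⟨t', h3, h4, h5⟩ := ih t₂ h2 k (u ++ labels t₁) z (by simpa using hk)
      exact ⟨t₁ * t', ⟨_, _, _, rfl, rfl, h3⟩, by simp only [minDepth_mul]; omega,
        by simpa using h5⟩

theorem everDefined_assocRel : EverDefined 2 (AssocRel : FreeMagma L → FreeMagma L → Prop) := by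
  intro t ht k u z hk
  obtain ⟨t₁, t₂, rfl, -, h⟩ := exists_mul_of_minDepth ht
  obtain ⟨t₂, t₃, rfl, -, -⟩ := exists_mul_of_minDepth h
  exact ⟨_, ⟨t₁, t₂, t₃, rfl, rfl⟩, by simp only [minDepth_mul]; omega,
    by simpa using hk.of_succ⟩

theorem everDefined_flip_assocRel :
    EverDefined 2 (flip AssocRel : FreeMagma L → FreeMagma L → Prop) := by
  intro t ht k u z hk
  obtain ⟨t₁, t₃, rfl, h, -⟩ := exists_mul_of_minDepth ht
  obtain ⟨t₁, t₂, rfl, -, -⟩ := exists_mul_of_minDepth h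
  exact ⟨_, ⟨t₁, t₂, t₃, rfl, rfl⟩, by simp only [minDepth_mul]; omega,
    by simpa using hk.of_succ⟩

theorem everDefined_semiRel : EverDefined 2 (SemiRel : FreeMagma L → FreeMagma L → Prop) := by
  intro t ht k u z hk
  obtain ⟨t₁, t₂, rfl, -, h⟩ := exists_mul_of_minDepth ht
  obtain ⟨t₂, t₃, rfl, -, -⟩ := exists_mul_of_minDepth h
  refine ⟨_, ⟨t₁, t₂, t₃, rfl, rfl⟩, ?_, ?_⟩
  · simp only [minDepth_mul, treeBracket_eq, minDepth_map]; omega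
  · have := hk.of_succ
    simp only [labels_mul, List.append_assoc] at this
    have := IsTwist.cross (u := u) (v := labels t₁) (w := labels t₂) (z := labels t₃ ++ z)
      (by simpa using this)
    simpa using this

/-- Here definedness depends on the labels and not only on the shape, and a twist is really
consumed. -/
theorem everDefined_flip_semiRel :
    EverDefined 2 (flip SemiRel : FreeMagma L → FreeMagma L → Prop) := by
  intro t ht k u z hk
  obtain ⟨s, t, rfl, -, h⟩ := exists_mul_of_minDepth ht
  obtain ⟨t₁, t₃, rfl, -, -⟩ := exists_mul_of_minDepth h
  simp only [labels_mul, List.append_assoc] at hk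
  obtain ⟨l, h1, h2⟩ := IsTwist.exists_cross (u := u) (w := labels s) (v := labels t₁)
    (z := labels t₃ ++ z) (by simpa using hk)
  obtain ⟨t₂, rfl, rfl⟩ := exists_map_eq _ _ _ h1
  exact ⟨_, ⟨t₁, t₂, t₃, rfl, rfl⟩, by simp only [minDepth_mul, minDepth_map]; omega,
    by simpa using h2⟩

end EverDefined

/-! ### The geometry monoid and `B_•` -/

/-- The partial injection acts on coloured trees like the element `x` of `B_•`, and it is defined
at all sufficiently deep trees with sufficiently twisted labels. -/
structure Tracks (f : AllTrees.{u} ≃. AllTrees.{u}) (x : BBullet) : Prop where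
  act : ∀ p q, f p = some q → ∃ (L : LCSystem.{u}) (t t' : FreeMagma L.carrier),
    p = ⟨L, t⟩ ∧ q = ⟨L, t'⟩ ∧ ∀ {Z : Type u} (J : Model L.carrier Z),
      J.act x (J.val (spine t)) = J.val (spine t')
  -- One constant `n` bounds the loss of both depth and twists; the reserves `d` and `k` are
  -- arbitrary, so that these bounds add under composition.
  dom : ∃ n, ∀ (L : LCSystem.{u}) (t : FreeMagma L.carrier) (d k : ℕ), n + d ≤ minDepth t →
    IsTwist (n + k) (labels t) → ∃ t', f ⟨L, t⟩ = some ⟨L, t'⟩ ∧ d ≤ minDepth t' ∧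
      IsTwist k (labels t')

theorem Tracks.one : Tracks.{u} 1 1 where
  act := by
    rintro ⟨L, t⟩ q h
    obtain rfl := Option.some.inj h
    exact ⟨L, t, t, rfl, rfl, fun J => J.act_one _⟩
  dom := ⟨0, fun L t d k hd hk => ⟨t, rfl, by omega, by simpa using hk⟩⟩

theorem Tracks.mul {f g : AllTrees.{u} ≃. AllTrees.{u}} {x y : BBullet} (hf : Tracks f x)
    (hg : Tracks g y) : Tracks (f * g) (x * y) where
  act := by
    intro p r h
    obtain ⟨q, h1, h2⟩ := (PEquiv.trans_eq_some f g p r).1 h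
    obtain ⟨L, t, t', rfl, rfl, h3⟩ := hf.act p q h1
    obtain ⟨M, s, s', e, rfl, h4⟩ := hg.act _ r h2
    cases e
    exact ⟨L, t, s', rfl, rfl, fun J => by rw [J.act_mul, h3, h4]⟩
  dom := by
    obtain ⟨m, hm⟩ := hf.dom
    obtain ⟨n, hn⟩ := hg.dom
    refine ⟨m + n, fun L t d k hd hk => ?_⟩
    obtain ⟨t', h1, h2, h3⟩ := hm L t (n + d) (n + k) (by omega) (by rwa [← add_assoc])
    obtain ⟨t'', h4, h5, h6⟩ := hn L t' d k h2 h3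
    exact ⟨t'', (PEquiv.trans_eq_some f g _ _).2 ⟨_, h1, h4⟩, h5, h6⟩

theorem Tracks.of_graph {f : AllTrees.{u} ≃. AllTrees.{u}} {x : BBullet} (n : ℕ)
    (r : ∀ L : LCSystem.{u}, FreeMagma L.carrier → FreeMagma L.carrier → Prop)
    (hf : ∀ p q, f p = some q ↔ ∃ L t t', p = ⟨L, t⟩ ∧ q = ⟨L, t'⟩ ∧ r L t t')
    (act : ∀ (L : LCSystem.{u}) t t', r L t t' → ∀ {Z : Type u} (J : Model L.carrier Z),
      J.act x (J.val (spine t)) = J.val (spine t'))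
    (dom : ∀ L, EverDefined n (r L)) : Tracks f x where
  act p q h := by
    obtain ⟨L, t, t', rfl, rfl, hr⟩ := (hf p q).1 h
    exact ⟨L, t, t', rfl, rfl, act L t t' hr⟩
  dom := by
    refine ⟨n + 1, fun L t d k hd hk => ?_⟩
    obtain ⟨t', h1, h2, h3⟩ := dom L t (by omega) k [] [] (by
      simpa using hk.mono (show k + 1 ≤ n + 1 + k by omega))
    exact ⟨t', (hf _ _).2 ⟨L, t, t', rfl, rfl, h1⟩, by omega, by simpa using h3⟩

theorem opA_eq_some (α : List Bool) (p q : AllTrees.{u}) :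
    opA α p = some q ↔ ∃ L t t', p = ⟨L, t⟩ ∧ q = ⟨L, t'⟩ ∧ Shift AssocRel α t t' := by
  refine (ofGraph_eq_some _ _ _ _).trans ⟨?_, ?_⟩
  · rintro ⟨L, t, t', h⟩
    exact ⟨L, t, t', rfl, rfl, h⟩
  · rintro ⟨L, t, t', rfl, rfl, h⟩
    exact ⟨L, t, t', h⟩

theorem opS_eq_some (α : List Bool) (p q : AllTrees.{u}) :
    opS α p = some q ↔ ∃ L t t', p = ⟨L, t⟩ ∧ q = ⟨L, t'⟩ ∧ Shift SemiRel α t t' := by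
  refine (ofGraph_eq_some _ _ _ _).trans ⟨?_, ?_⟩
  · rintro ⟨L, t, t', h⟩
    exact ⟨L, t, t', rfl, rfl, h⟩
  · rintro ⟨L, t, t', rfl, rfl, h⟩
    exact ⟨L, t, t', h⟩

theorem symm_eq_some_of_graph {f : AllTrees.{u} ≃. AllTrees.{u}} {α : List Bool}
    {r : ∀ L : LCSystem.{u}, FreeMagma L.carrier → FreeMagma L.carrier → Prop}
    (hf : ∀ p q, f p = some q ↔ ∃ L t t', p = ⟨L, t⟩ ∧ q = ⟨L, t'⟩ ∧ Shift (r L) α t t')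
    (p q : AllTrees.{u}) :
    f.symm p = some q ↔ ∃ L t t', p = ⟨L, t⟩ ∧ q = ⟨L, t'⟩ ∧ Shift (flip (r L)) α t t' := by
  rw [PEquiv.eq_some_iff, hf]
  constructor
  · rintro ⟨L, t, t', rfl, rfl, h⟩
    exact ⟨L, t', t, rfl, rfl, (shift_flip _ _ _ _).2 h⟩
  · rintro ⟨L, t, t', rfl, rfl, h⟩
    exact ⟨L, t', t, rfl, rfl, (shift_flip _ _ _ _).1 h⟩

theorem tracks_opA (α : List Bool) : Tracks.{u} (opA α) (eltA α) :=
  Tracks.of_graph (2 + α.length) (fun _ => Shift AssocRel α) (opA_eq_some α)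
    (fun _ t t' h _ J => J.act_eltA α t t' h) fun _ => everDefined_assocRel.shift α

theorem tracks_opA_symm (α : List Bool) : Tracks.{u} (opA α).symm (eltA α)⁻¹ :=
  Tracks.of_graph (2 + α.length) (fun _ => Shift (flip AssocRel) α)
    (symm_eq_some_of_graph (opA_eq_some α))
    (fun _ t t' h _ J => J.act_inv (J.act_eltA α t' t ((shift_flip _ _ _ _).1 h)))
    fun _ => everDefined_flip_assocRel.shift α

theorem tracks_opS (α : List Bool) : Tracks.{u} (opS α) (eltS α) :=
  Tracks.of_graph (2 + α.length) (fun _ => Shift SemiRel α) (opS_eq_some α)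
    (fun _ t t' h _ J => J.act_eltS α t t' h) fun _ => everDefined_semiRel.shift α

theorem tracks_opS_symm (α : List Bool) : Tracks.{u} (opS α).symm (eltS α)⁻¹ :=
  Tracks.of_graph (2 + α.length) (fun _ => Shift (flip SemiRel) α)
    (symm_eq_some_of_graph (opS_eq_some α))
    (fun _ t t' h _ J => J.act_inv (J.act_eltS α t' t ((shift_flip _ _ _ _).1 h)))
    fun _ => everDefined_flip_semiRel.shift α

theorem exists_tracks (f : geomMonoid.{u}) : ∃ x, Tracks f.1 x := by
  obtain ⟨f, hf⟩ := f
  induction hf using Submonoid.closure_induction with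
  | mem f hf =>
    obtain ⟨α, rfl | rfl | rfl | rfl⟩ := hf
    · exact ⟨_, tracks_opA α⟩
    · exact ⟨_, tracks_opA_symm α⟩
    · exact ⟨_, tracks_opS α⟩
    · exact ⟨_, tracks_opS_symm α⟩
  | one => exact ⟨1, Tracks.one⟩
  | mul f g _ _ hf hg =>
    obtain ⟨x, hx⟩ := hf
    obtain ⟨y, hy⟩ := hg
    exact ⟨x * y, hx.mul hy⟩

/-- Two tracked partial injections are defined at a common tree coloured by `B_•`. -/
theorem Tracks.exists_common {f g : AllTrees.{u} ≃. AllTrees.{u}} {x y : BBullet}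
    (hf : Tracks f x) (hg : Tracks g y) : ∃ t t' t'' : FreeMagma bSystem.{u}.carrier,
      f ⟨_, t⟩ = some ⟨_, t'⟩ ∧ g ⟨_, t⟩ = some ⟨_, t''⟩ := by
  obtain ⟨m, hm⟩ := hf.dom
  obtain ⟨n, hn⟩ := hg.dom
  have : Nonempty bSystem.{u}.carrier := ⟨ULift.up 1⟩
  obtain ⟨t₀, h₀⟩ := exists_minDepth_eq (L := bSystem.{u}.carrier) (m + n)
  obtain ⟨t, h1, h2⟩ := exists_relabel t₀ (fullTwist^[m + n] (labels t₀))
    (length_iterate_fullTwist _ _)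
  have ht : IsTwist (m + n) (labels t) := ⟨_, h1⟩
  obtain ⟨t', h3, -⟩ := hm _ t 0 0 (by omega) (ht.mono (by omega))
  obtain ⟨t'', h4, -⟩ := hn _ t 0 0 (by omega) (ht.mono (by omega))
  exact ⟨t, t', t'', h3, h4⟩

/-- The action of a tracked partial injection at a tree. -/
theorem Tracks.act_eq {f : AllTrees.{u} ≃. AllTrees.{u}} {x : BBullet} (hf : Tracks f x)
    {L : LCSystem.{u}} {t t' : FreeMagma L.carrier} (h : f ⟨L, t⟩ = some ⟨L, t'⟩) {Z : Type u}
    (J : Model L.carrier Z) : J.act x (J.val (spine t)) = J.val (spine t') := by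
  obtain ⟨M, s, s', e, e', h⟩ := hf.act _ _ h
  cases e
  cases e'
  exact h J

/-- Forwards, agreement at a common tree is evaluated in `bModel`, where the action is cancellable.
Backwards, both values have the same image in `slotModel`, which separates trees. -/
theorem Tracks.nearEq_iff {f g : AllTrees.{u} ≃. AllTrees.{u}} {x y : BBullet}
    (hf : Tracks f x) (hg : Tracks g y) : NearEq f g ↔ x = y := by
  obtain ⟨t, t', t'', h1, h2⟩ := hf.exists_common hg
  constructor
  · rintro ⟨-, h⟩
    have e := h ⟨_, t⟩ (by rw [h1]; rfl) (by rw [h2]; rfl)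
    rw [h1, h2] at e
    cases e
    have e := (hf.act_eq h1 bModel).trans (hg.act_eq h2 bModel).symm
    exact mul_left_cancel (congrArg ULift.down e)
  · rintro rfl
    refine ⟨⟨⟨_, t⟩, by rw [h1]; rfl, by rw [h2]; rfl⟩, fun p hp hp' => ?_⟩
    obtain ⟨q, hq⟩ := Option.isSome_iff_exists.1 hp
    obtain ⟨q', hq'⟩ := Option.isSome_iff_exists.1 hp'
    obtain ⟨L, s, s', rfl, rfl, k⟩ := hf.act p q hq
    obtain ⟨M, r, r', e, rfl, k'⟩ := hg.act _ q' hq'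
    cases e
    rw [hq, hq', slotModel_val_injective L ((k (slotModel L)).symm.trans (k' (slotModel L)))]

theorem Tracks.unique {f : AllTrees.{u} ≃. AllTrees.{u}} {x y : BBullet} (hx : Tracks f x)
    (hy : Tracks f y) : x = y := by
  refine (hx.nearEq_iff hy).1 ⟨?_, fun _ _ _ => rfl⟩
  obtain ⟨t, t', -, h, -⟩ := hx.exists_common hx
  exact ⟨⟨_, t⟩, by rw [h]; rfl, by rw [h]; rfl⟩

/-- The homomorphism from the geometry monoid to `B_•`. -/
noncomputable def toBBullet : geomMonoid.{u} →* BBullet where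
  toFun f := (exists_tracks f).choose
  map_one' := (exists_tracks 1).choose_spec.unique Tracks.one
  map_mul' f g := (exists_tracks (f * g)).choose_spec.unique
    ((exists_tracks f).choose_spec.mul (exists_tracks g).choose_spec)

theorem tracks_toBBullet (f : geomMonoid.{u}) : Tracks f.1 (toBBullet f) :=
  (exists_tracks f).choose_spec

/-! ### Surjectivity onto `B_•` -/

theorem outerElt_replicate (b e : BBullet) (i : ℕ) :
    outerElt b e (List.replicate i true) = sh^[i] b := by
  induction i with
  | zero => rfl
  | succ i ih =>
    rw [Function.iterate_succ_apply', ← ih]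
    rfl

theorem toBBullet_surjective : Function.Surjective toBBullet.{u} := by
  have hmem : ∀ {f : AllTrees.{u} ≃. AllTrees.{u}} (α : List Bool)
      (_ : f = opA α ∨ f = (opA α).symm ∨ f = opS α ∨ f = (opS α).symm) {x : BBullet},
      Tracks f x → ∃ f, toBBullet.{u} f = x := fun α hf x h =>
    ⟨⟨_, Submonoid.subset_closure ⟨α, hf⟩⟩, (tracks_toBBullet _).unique h⟩
  have hA : ∀ i, eltA (List.replicate i true) = bA i := fun i => by
    rw [eltA, outerElt_replicate, sh_iterate_bA, zero_add]
  have hS : ∀ i, eltS (List.replicate i true) = bS i := fun i => by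
    rw [eltS, outerElt_replicate, sh_iterate_bS, zero_add]
  -- The source is only a monoid, so inverses are carried through the induction; the inverse
  -- operators supply those of the generators.
  have key : ∀ x, (∃ f, toBBullet.{u} f = x) ∧ ∃ f, toBBullet.{u} f = x⁻¹ := by
    intro x
    induction x using BBullet.induction with
    | one => exact ⟨⟨1, map_one _⟩, ⟨1, by rw [map_one, inv_one]⟩⟩
    | a i =>
      rw [← hA]
      exact ⟨hmem _ (Or.inl rfl) (tracks_opA _), hmem _ (Or.inr (Or.inl rfl)) (tracks_opA_symm _)⟩
    | σ i =>
      rw [← hS]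
      exact ⟨hmem _ (Or.inr (Or.inr (Or.inl rfl))) (tracks_opS _),
        hmem _ (Or.inr (Or.inr (Or.inr rfl))) (tracks_opS_symm _)⟩
    | mul x y hx hy =>
      obtain ⟨⟨f, rfl⟩, f', hf'⟩ := hx
      obtain ⟨⟨g, rfl⟩, g', hg'⟩ := hy
      exact ⟨⟨f * g, map_mul _ _ _⟩, g' * f', by rw [map_mul, hf', hg', mul_inv_rev]⟩
    | inv x hx => exact ⟨hx.2, by rw [inv_inv]; exact hx.1⟩
  exact fun x => (key x).1

end GeomGroup

theorem proposition5p12 :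
    ∃ c : Con GeomGroup.geomMonoid.{u},
      (∀ f g : GeomGroup.geomMonoid.{u}, c f g ↔ GeomGroup.NearEq f.1 g.1) ∧
      Nonempty (c.Quotient ≃* GeomGroup.BBullet) :=
  ⟨Con.ker GeomGroup.toBBullet,
    fun f g => ((GeomGroup.tracks_toBBullet f).nearEq_iff (GeomGroup.tracks_toBBullet g)).symm,
    ⟨Con.quotientKerEquivOfSurjective _ GeomGroup.toBBullet_surjective⟩⟩
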